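/- **Setting.** Let $\vec G$ be a directed graph with vertex set $[n]$ and edges $e_1,\dots,e_m$ which is a square two dimensional grid graph: up to labelling and orientation of the edges it is the $k\times k$ grid with $n=k^2$, $k\ge 1$. Let $D\in\{-1,0,1\}^{m\times n}$ be its incidence matrix (row $i$ has $-1$ at the tail and $+1$ at the head of $e_i$). For $S\subseteq[m]$ let $D_{-S}$ be the matrix of the rows of $D$ with index outside $S$, let $r_S=\dim\{v: D_{-S}v=0\}$, and let $\vec G_{-S}$ be $\vec G$ with the edges $e_i$, $i\in S$, removed. Let $\mathcal S(D)$ be the family of sets of the form $\{j\in[m]:(Df)_j\ne0\}$, $f\in\mathbb R^n$. We observe $Y=f^0+\epsilon$, where $f^0\in\mathbb R^n$, $\epsilon\sim\mathcal N_n(0,\sigma^2 I_n)$ and $\sigma>0$; write $\|f\|_n^2=\frac1n\sum_{i=1}^n f_i^2$ and let $$\hat f=\arg\min_{f\in\mathbb R^n}\left\{\|Y-f\|_n^2+2\lambda\|Df\|_1\right\}.$$ **Corollary.** There is a universal constant $C_0>0$ such that the following holds for every $C\ge C_0$. (i) Let $S\in\mathcal S(D)$ be such that every connected component of $\vec G_{-S}$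 is a square two dimensional grid graph (of any side length $\ge 1$), let $x,t>0$ and $$\lambda\ \ge\ C\,\frac{\sigma}{n}\sqrt{\log n\,(\log(2n)+t)} .$$ Then, for every $f\in\mathbb R^n$, with probability at least $1-e^{-x}-e^{-t}$, $$\|\hat f-f^0\|_n^2\le\|f-f^0\|_n^2+\frac{\sigma^2}{n}\left(\sqrt{2x}+\sqrt{r_S}\right)^2+4\lambda\|Df\|_1 .$$ In particular, if $\lambda= C\frac{\sigma}{n}\sqrt{\log n\,(\log(2n)+t)}$, then, for every $f\in\mathbb R^n$, with probability at least $1-e^{-x}-e^{-t}$, $$\|\hat f-f^0\|_n^2\le\|f-f^0\|_n^2+\frac{\sigma^2}{n}\left(\sqrt{2x}+\sqrt{r_S}\right)^2+4C\,\frac{\sigma}{n}\sqrt{\log n\,(\log(2n)+t)}\;\|Df\|_1 .$$ (ii) (Rate under the canonical scaling.) For all $\sigma,x,t,K,M>0$ there is a constant $A>0$, depending only on these and on $C$, such that the following holds. Let $n\ge2$, let $S$ be as in (i) with $r_S\le M\,n^{1/2}\log n$, let $\|Df^0\|_1\le K n^{1/2}$, and let $\lambda=C\frac{\sigma}{n}\sqrt{\log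 n\,(\log(2n)+t)}$. Then, with probability at least $1-e^{-x}-e^{-t}$, $$\|\hat f-f^0\|_n^2\le A\,\frac{\log n}{\sqrt n}.$$ -/

import Mathlib

open MeasureTheory ProbabilityTheory

noncomputable section

/-- The squared normalised Euclidean norm `‖f‖²ₙ = (∑ᵢ fᵢ²) / n` of `f ∈ ℝⁿ`. -/
def normSqN {n : ℕ} (f : Fin n → ℝ) : ℝ :=
  (∑ i, f i ^ 2) / n

/-- The `ℓ¹`-norm of a vector. -/
def normL1 {m : ℕ} (v : Fin m → ℝ) : ℝ :=
  ∑ i, |v i|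

/-- The law `𝒩ₙ(0, σ² Iₙ)` of `n` independent centred Gaussians with variance `σ²`. -/
def isotropicGaussian (n : ℕ) (σ : ℝ) : Measure (Fin n → ℝ) :=
  Measure.pi fun _ => gaussianReal 0 (σ ^ 2).toNNReal

/-! ### Analysis operators -/

/-- `IsAnalysisEstimator D lam y g`: the vector `g` minimises
`f ↦ ‖y - f‖²ₙ + 2 lam ‖D f‖₁` over `ℝⁿ`. -/
def IsAnalysisEstimator {m n : ℕ} (D : Matrix (Fin m) (Fin n) ℝ) (lam : ℝ)
    (y g : Fin n → ℝ) : Prop :=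
  ∀ f : Fin n → ℝ,
    normSqN (y - g) + 2 * lam * normL1 (D.mulVec g) ≤
      normSqN (y - f) + 2 * lam * normL1 (D.mulVec f)

/-- The admissible active sets of `D`: the sets of the form
`{j | (D f)ⱼ ≠ 0}` for some `f ∈ ℝⁿ`. -/
def admissibleActiveSets {m n : ℕ} (D : Matrix (Fin m) (Fin n) ℝ) : Set (Set (Fin m)) :=
  {S | ∃ f : Fin n → ℝ, S = {j | D.mulVec f j ≠ 0}}

/-- The matrix `D_{-S}` of the rows of `D` whose index is not in `S`. -/
def rowsOutside {m n : ℕ} (D : Matrix (Fin m) (Fin n) ℝ) (S : Set (Fin m)) :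
    Matrix {i : Fin m // i ∉ S} (Fin n) ℝ :=
  D.submatrix Subtype.val id

/-- `r_S`, the dimension of the nullspace of `D_{-S}`. -/
def nullDim {m n : ℕ} (D : Matrix (Fin m) (Fin n) ℝ) (S : Set (Fin m)) : ℕ :=
  Module.finrank ℝ (LinearMap.ker (rowsOutside D S).mulVecLin)

/-! ### Directed graphs and square grids -/

/-- A directed graph with vertices `[n]` and edges `e₁, …, eₘ`, without loops;
the `i`-th edge goes from `tail i` to `head i`. -/
structure DirGraph (n m : ℕ) where
  tail : Fin m → Fin n
  head : Fin m → Fin n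
  tail_ne_head : ∀ i, tail i ≠ head i

namespace DirGraph

variable {n m : ℕ}

/-- The incidence matrix: `-1` at the tail and `1` at the head of each edge. -/
def incidence (G : DirGraph n m) : Matrix (Fin m) (Fin n) ℝ :=
  fun i j => if j = G.tail i then -1 else if j = G.head i then 1 else 0

/-- The undirected graph underlying `(V, E ∖ E_S)`. -/
def underlyingOutside (G : DirGraph n m) (S : Set (Fin m)) : SimpleGraph (Fin n) :=
  SimpleGraph.fromRel fun u v => ∃ i, i ∉ S ∧ G.tail i = u ∧ G.head i = v

end DirGraph

/-- The undirected `k × k` grid graph: two vertices are adjacent if they agree in one coordinate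
and differ by one in the other. -/
def squareGrid (k : ℕ) : SimpleGraph (Fin k × Fin k) :=
  (SimpleGraph.pathGraph k).boxProd (SimpleGraph.pathGraph k)

namespace DirGraph

variable {n m : ℕ}

/-- `G` is a square two dimensional grid graph with some labelling of vertices and edges and some
orientation of each edge: there is one directed edge for each edge of the `k × k` grid. -/
def IsSquareGrid (G : DirGraph n m) : Prop :=
  (Function.Injective fun i => s(G.tail i, G.head i)) ∧
    ∃ k : ℕ, 1 ≤ k ∧ Nonempty (G.underlyingOutside ∅ ≃g squareGrid k)

/-- Every connected component of `(V, E ∖ E_S)` is a square two dimensional grid graph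
(of a side length that may depend on the component). -/
def ComponentsSquare (G : DirGraph n m) (S : Set (Fin m)) : Prop :=
  ∀ c : (G.underlyingOutside S).ConnectedComponent,
    ∃ k : ℕ, 1 ≤ k ∧ Nonempty ((G.underlyingOutside S).induce c.supp ≃g squareGrid k)

end DirGraph

/-- The order of the tuning parameter, `σ √(log n (log (2n) + t)) / n`. -/
def gridLevel (n : ℕ) (σ t : ℝ) : ℝ :=
  σ / n * √(Real.log n * (Real.log (2 * n) + t))

end

/-! Let `h = f̂ - f` and let `N` be the nullspace of `D_{-S}`. The noise term `⟨ε, h⟩` splits along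
`N` and its orthogonal complement.

On `N`, Young's inequality bounds `2⟨ε, P_N h⟩` by `‖h‖² + ‖P_N ε‖²`. The first term is absorbed by
the extra `‖f̂ - f‖²ₙ` that strong convexity provides (`IsAnalysisEstimator.basic_ineq`); the second
is `σ²` times a chi-square variable with `r_S` degrees of freedom
(`pi_gaussianReal_orthonormal_tail`).

The other part `h'` has zero sum on every component of the graph without `S`. On a square grid, a
point value minus the mean is the pairing of the gradient with a flow that spreads a unit mass at
`p` uniformly over the grid. Spreading through windows of side 1, 2, 3, … costs at most `1/r²` per
edge at scale `r`, and only within distance `r` of `p`. The flow from `p` is thus of order `1/|p -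
u|` at `u`, and its squares summed over `p` are of order `log k`: this two dimensional computation
(`sum_flowBound_sq_le`) is the source of the factor `√log n` in `λ`. Hence `⟨ε, h'⟩` is at most
`‖Dh‖₁` times a maximum, over pairs of vertices, of Gaussians with variance `O(σ² log n)`, and a
union bound shows that `λ` dominates it. The triangle inequality `‖Dh‖₁ ≤ ‖Df̂‖₁ + ‖Df‖₁` then
cancels `‖Df̂‖₁`.

These steps are joined in `DirGraph.exists_noise_decomposition` and `DirGraph.oracle_inequality`.
The good event depends on the noise alone, so the bound holds for all `f` simultaneously; the rate
follows by taking `f = f⁰`. -/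

/-! ### Flows on the square grid -/

/-- The window of length `r` inside `{0, …, k - 1}` that starts at `x`, moved to the left if it
would leave this range. -/
def gridWindow (k r x : ℕ) : Finset ℕ :=
  Finset.Ico (min x (k - r)) (min x (k - r) + r)

/-- The average of `v` over `gridWindow k r x`. -/
noncomputable def windowAvg (k r x : ℕ) (v : ℕ → ℝ) : ℝ :=
  (∑ i ∈ gridWindow k r x, v i) / r

/-- The density of the uniform distribution on `gridWindow k r x`. -/
noncomputable def windowWeight (k r x i : ℕ) : ℝ :=
  if i ∈ gridWindow k r x then 1 / (r : ℝ) else 0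

lemma gridWindow_subset {k r x : ℕ} (hr : r ≤ k) : gridWindow k r x ⊆ Finset.range k := by
  intro i hi
  simp only [gridWindow, Finset.mem_Ico, Finset.mem_range] at *
  omega

lemma dist_lt_of_mem_gridWindow {k r x i : ℕ} (hr : r ≤ k) (hx : x < k)
    (hi : i ∈ gridWindow k r x) : i < x + r ∧ x < i + r := by
  simp only [gridWindow, Finset.mem_Ico] at hi
  omega

lemma windowAvg_eq_sum_weight {k r x : ℕ} (hr : r ≤ k) (v : ℕ → ℝ) :
    windowAvg k r x v = ∑ i ∈ Finset.range k, windowWeight k r x i * v i := by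
  simp only [windowAvg, windowWeight, ite_mul, zero_mul]
  rw [← Finset.sum_filter, Finset.filter_mem_eq_inter,
    Finset.inter_eq_right.2 (gridWindow_subset hr), Finset.sum_div]
  exact Finset.sum_congr rfl fun i _ => by ring

lemma windowAvg_one {k x : ℕ} (hx : x < k) (v : ℕ → ℝ) : windowAvg k 1 x v = v x := by
  have : min x (k - 1) = x := by omega
  simp [windowAvg, gridWindow, this]

lemma windowAvg_self {k x : ℕ} (v : ℕ → ℝ) :
    windowAvg k k x v = (∑ i ∈ Finset.range k, v i) / k := by
  simp [windowAvg, gridWindow]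

/-- Summation by parts: the increment from `a + i` to `a + i + 1` lies on the way to the last point
for exactly `i + 1` of the summands. -/
lemma sum_range_sub_last (a r : ℕ) (v : ℕ → ℝ) :
    (∑ i ∈ Finset.range r, v (a + i)) - r * v (a + r) =
      ∑ i ∈ Finset.range r, -((i : ℝ) + 1) * (v (a + i + 1) - v (a + i)) := by
  induction r with
  | zero => simp
  | succ r ih =>
    rw [Finset.sum_range_succ, Finset.sum_range_succ, ← ih]
    push_cast
    rw [← add_assoc]
    ring

lemma sum_range_sub_first (b r : ℕ) (v : ℕ → ℝ) :
    (∑ i ∈ Finset.range r, v (b + i + 1)) - r * v b =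
      ∑ i ∈ Finset.range r, ((r : ℝ) - i) * (v (b + i + 1) - v (b + i)) := by
  induction r with
  | zero => simp
  | succ r ih =>
    have h : ∑ i ∈ Finset.range (r + 1), (v (b + i + 1) - v (b + i)) = v (b + r + 1) - v b := by
      have := Finset.sum_range_sub (fun i => v (b + i)) (r + 1)
      simpa [add_assoc] using this
    have h2 : ∑ i ∈ Finset.range (r + 1), (((r + 1 : ℕ) : ℝ) - i) * (v (b + i + 1) - v (b + i)) =
        ∑ i ∈ Finset.range (r + 1), ((r : ℝ) - i) * (v (b + i + 1) - v (b + i)) +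
        ∑ i ∈ Finset.range (r + 1), (v (b + i + 1) - v (b + i)) := by
      rw [← Finset.sum_add_distrib]
      refine Finset.sum_congr rfl fun i _ => ?_
      push_cast
      ring
    rw [h2, h, Finset.sum_range_succ, Finset.sum_range_succ, ← ih]
    push_cast
    ring

/-- Consecutive windows are nested and differ in one end point, so the difference of averages is `(∑
v - r * v(new)) / (r(r+1))`, the sum being over the shorter window. Each increment is counted at
most `r` times, so its coefficient is at most `1/r`. The new point is on the right until the window
reaches the border, and on the left from then on. -/
lemma exists_windowAvg_sub {k r x : ℕ} (hr : 1 ≤ r) (hrk : r < k) (hx : x < k) :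
    ∃ c : ℕ → ℝ,
      (∀ v : ℕ → ℝ, windowAvg k r x v - windowAvg k (r + 1) x v =
        ∑ j ∈ Finset.range k, c j * (v (j + 1) - v j)) ∧
      (∀ j, k ≤ j + 1 → c j = 0) ∧
      ∀ j, |c j| ≤ if j ≤ x + r ∧ x ≤ j + r then 1 / (r : ℝ) else 0 := by
  have hr0 : (0 : ℝ) < r := by exact_mod_cast hr
  by_cases hxr : x + r < k
  · refine ⟨fun j => if j ∈ Finset.Ico x (x + r) then -((j : ℝ) - x + 1) / (r * (r + 1)) else 0,
      fun v => ?_, fun j hj => ?_, fun j => ?_⟩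
    · have h1 : min x (k - r) = x := by omega
      have h2 : min x (k - (r + 1)) = x := by omega
      simp only [windowAvg, gridWindow, h1, h2, ite_mul, zero_mul]
      rw [← Finset.sum_filter, Finset.filter_mem_eq_inter, Finset.inter_eq_right.2,
        Finset.sum_Ico_eq_sum_range, Finset.sum_Ico_eq_sum_range, Finset.sum_Ico_eq_sum_range]
      · simp only [add_tsub_cancel_left]
        rw [Finset.sum_range_succ]
        have := sum_range_sub_last x r v
        have h3 : ∑ i ∈ Finset.range r, -(((x + i : ℕ) : ℝ) - x + 1) / (r * (r + 1)) *
            (v (x + i + 1) - v (x + i)) =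
            (∑ i ∈ Finset.range r, -((i : ℝ) + 1) * (v (x + i + 1) - v (x + i))) /
              (r * (r + 1)) := by
          rw [Finset.sum_div]
          refine Finset.sum_congr rfl fun i _ => ?_
          push_cast
          ring
        rw [h3, ← this]
        push_cast
        field_simp
        ring
      · intro j hj
        simp only [Finset.mem_Ico, Finset.mem_range] at *
        omega
    · refine if_neg ?_
      simp only [Finset.mem_Ico]
      omega
    · dsimp only
      split_ifs with h1 h2 h2
      · rw [Finset.mem_Ico] at h1
        have h3 : (x : ℝ) ≤ j := by exact_mod_cast h1.1
        have h4 : (j : ℝ) + 1 ≤ x + r := by exact_mod_cast h1.2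
        rw [neg_div, abs_neg, abs_of_nonneg (div_nonneg (by linarith) (by positivity)),
          div_le_div_iff₀ (by positivity) hr0]
        nlinarith
      · rw [Finset.mem_Ico] at h1
        omega
      · simp
      · simp
  · refine ⟨fun j => if j ∈ Finset.Ico (k - (r + 1)) (k - (r + 1) + r) then
        ((k : ℝ) - 1 - j) / (r * (r + 1)) else 0,
      fun v => ?_, fun j hj => ?_, fun j => ?_⟩
    · have h1 : min x (k - r) = k - (r + 1) + 1 := by omega
      have h2 : min x (k - (r + 1)) = k - (r + 1) := by omega
      simp only [windowAvg, gridWindow, h1, h2, ite_mul, zero_mul]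
      rw [← Finset.sum_filter, Finset.filter_mem_eq_inter, Finset.inter_eq_right.2,
        Finset.sum_Ico_eq_sum_range, Finset.sum_Ico_eq_sum_range, Finset.sum_Ico_eq_sum_range]
      · simp only [add_tsub_cancel_left]
        rw [Finset.sum_range_succ']
        have := sum_range_sub_first (k - (r + 1)) r v
        have h3 : ∑ i ∈ Finset.range r, ((k : ℝ) - 1 - ((k - (r + 1) + i : ℕ) : ℝ)) /
            (r * (r + 1)) * (v (k - (r + 1) + i + 1) - v (k - (r + 1) + i)) =
            (∑ i ∈ Finset.range r, ((r : ℝ) - i) *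
              (v (k - (r + 1) + i + 1) - v (k - (r + 1) + i))) / (r * (r + 1)) := by
          rw [Finset.sum_div]
          refine Finset.sum_congr rfl fun i _ => ?_
          push_cast [show r + 1 ≤ k from hrk]
          ring
        rw [h3, ← this]
        have h4 : ∀ i, k - (r + 1) + 1 + i = k - (r + 1) + i + 1 := fun i => by omega
        simp only [h4, add_zero, ← add_assoc]
        push_cast
        field_simp
        ring
      · intro j hj
        simp only [Finset.mem_Ico, Finset.mem_range] at *
        omega
    · refine if_neg ?_
      simp only [Finset.mem_Ico]
      omega
    · dsimp only
      split_ifs with h1 h2 h2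
      · rw [Finset.mem_Ico] at h1
        have h3 : (k : ℝ) ≤ j + (r + 1) := by exact_mod_cast (by omega : k ≤ j + (r + 1))
        have h4 : (j : ℝ) + 1 ≤ k := by exact_mod_cast (by omega : j + 1 ≤ k)
        rw [abs_of_nonneg (div_nonneg (by linarith) (by positivity)),
          div_le_div_iff₀ (by positivity) hr0]
        nlinarith
      · rw [Finset.mem_Ico] at h1
        omega
      · simp
      · simp

/-- The sum of `1 / r²` over the radii `1 ≤ r < k` for which the sup-norm ball of radius `r` around
`p` contains `u`. -/
noncomputable def flowBound (k : ℕ) (p u : ℕ × ℕ) : ℝ :=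
  ∑ r ∈ Finset.Ico 1 k,
    if (u.1 ≤ p.1 + r ∧ p.1 ≤ u.1 + r) ∧ (u.2 ≤ p.2 + r ∧ p.2 ≤ u.2 + r)
    then 1 / (r : ℝ) ^ 2 else 0

lemma abs_windowWeight_le {k r s x i : ℕ} (hr : 1 ≤ r) (hrs : r ≤ s) (hs : s ≤ r + 1) (hsk : s ≤ k)
    (hx : x < k) :
    |windowWeight k s x i| ≤ if i ≤ x + r ∧ x ≤ i + r then 1 / (r : ℝ) else 0 := by
  have hr0 : (0 : ℝ) < r := by exact_mod_cast hr
  have hrs' : (r : ℝ) ≤ s := by exact_mod_cast hrs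
  unfold windowWeight
  split_ifs with h1 h2 h2
  · rw [abs_of_nonneg (by positivity)]
    gcongr
  · have := dist_lt_of_mem_gridWindow hsk hx h1
    omega
  · simp
  · simp

/-- Telescoping over square windows of side `r = 1, …, k`, from the value at `p` to the mean. Each
step enlarges one coordinate at a time, and each product of a one dimensional flow with a window
density has size at most `1/r * 1/r`. -/
lemma exists_grid_flow_nat {k : ℕ} {p : ℕ × ℕ} (hp1 : p.1 < k) (hp2 : p.2 < k) :
    ∃ a b : ℕ → ℕ → ℝ,
      (∀ v : ℕ → ℕ → ℝ,
        v p.1 p.2 - (∑ x ∈ Finset.range k, ∑ y ∈ Finset.range k, v x y) / (k : ℝ) ^ 2 =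
          ∑ x ∈ Finset.range k, ∑ y ∈ Finset.range k,
            (a x y * (v (x + 1) y - v x y) + b x y * (v x (y + 1) - v x y))) ∧
      (∀ x y, k ≤ x + 1 → a x y = 0) ∧ (∀ x y, k ≤ y + 1 → b x y = 0) ∧
      (∀ x y, |a x y| ≤ flowBound k p (x, y)) ∧ (∀ x y, |b x y| ≤ flowBound k p (x, y)) := by
  have H : ∀ r x : ℕ, ∃ c : ℕ → ℝ, 1 ≤ r → r < k → x < k →
      (∀ v : ℕ → ℝ, windowAvg k r x v - windowAvg k (r + 1) x v =
        ∑ j ∈ Finset.range k, c j * (v (j + 1) - v j)) ∧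
      (∀ j, k ≤ j + 1 → c j = 0) ∧
      ∀ j, |c j| ≤ if j ≤ x + r ∧ x ≤ j + r then 1 / (r : ℝ) else 0 := by
    intro r x
    by_cases h : 1 ≤ r ∧ r < k ∧ x < k
    · obtain ⟨c, hc⟩ := exists_windowAvg_sub h.1 h.2.1 h.2.2
      exact ⟨c, fun _ _ _ => hc⟩
    · exact ⟨0, fun h1 h2 h3 => absurd ⟨h1, h2, h3⟩ h⟩
  choose c hc using H
  -- The first coordinate is enlarged while the second window still has side `r`; the second one
  -- afterwards, when the first window already has side `r + 1`.
  refine ⟨fun x y => ∑ r ∈ Finset.Ico 1 k, c r p.1 x * windowWeight k r p.2 y,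
    fun x y => ∑ r ∈ Finset.Ico 1 k, windowWeight k (r + 1) p.1 x * c r p.2 y,
    fun v => ?_, fun x y h => ?_, fun x y h => ?_, fun x y => ?_, fun x y => ?_⟩
  · set T : ℕ → ℝ := fun r => windowAvg k r p.1 fun x => windowAvg k r p.2 (v x) with hT
    have h1 : T 1 = v p.1 p.2 := by simp [hT, windowAvg_one hp1, windowAvg_one hp2]
    have hk : T k = (∑ x ∈ Finset.range k, ∑ y ∈ Finset.range k, v x y) / (k : ℝ) ^ 2 := by
      simp only [hT, windowAvg_self]
      rw [← Finset.sum_div, div_div, sq]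
    have hstep : ∀ r ∈ Finset.Ico 1 k, T r - T (r + 1) =
        ∑ x ∈ Finset.range k, ∑ y ∈ Finset.range k,
          (c r p.1 x * windowWeight k r p.2 y * (v (x + 1) y - v x y) +
            windowWeight k (r + 1) p.1 x * c r p.2 y * (v x (y + 1) - v x y)) := by
      intro r hr
      rw [Finset.mem_Ico] at hr
      have e1 := (hc r p.1 hr.1 hr.2 hp1).1 (fun x => windowAvg k r p.2 (v x))
      have e2 : ∀ x, windowAvg k r p.2 (v x) - windowAvg k (r + 1) p.2 (v x) = _ :=
        fun x => (hc r p.2 hr.1 hr.2 hp2).1 (v x)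
      have e3 : T r - T (r + 1) = (∑ x ∈ Finset.range k, c r p.1 x *
          (windowAvg k r p.2 (v (x + 1)) - windowAvg k r p.2 (v x))) +
          ∑ x ∈ Finset.range k, windowWeight k (r + 1) p.1 x *
            (windowAvg k r p.2 (v x) - windowAvg k (r + 1) p.2 (v x)) := by
        rw [← e1]
        simp only [mul_sub, Finset.sum_sub_distrib]
        rw [← windowAvg_eq_sum_weight hr.2, ← windowAvg_eq_sum_weight hr.2]
        ring
      rw [e3, ← Finset.sum_add_distrib]
      refine Finset.sum_congr rfl fun x _ => ?_
      rw [e2, Finset.sum_add_distrib, windowAvg_eq_sum_weight hr.2.le,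
        windowAvg_eq_sum_weight hr.2.le, ← Finset.sum_sub_distrib, Finset.mul_sum, Finset.mul_sum]
      congr 1
      · exact Finset.sum_congr rfl fun y _ => by ring
      · exact Finset.sum_congr rfl fun y _ => by ring
    have htel : T 1 - T k = ∑ r ∈ Finset.Ico 1 k, (T r - T (r + 1)) := by
      rw [Finset.sum_Ico_eq_sum_range]
      have := Finset.sum_range_sub' (fun i => T (1 + i)) (k - 1)
      have hk1 : 1 + (k - 1) = k := by omega
      simp only [hk1, add_zero, ← add_assoc] at this
      exact this.symm
    rw [← h1, ← hk, htel, Finset.sum_congr rfl hstep, Finset.sum_comm]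
    refine Finset.sum_congr rfl fun x _ => ?_
    rw [Finset.sum_comm]
    refine Finset.sum_congr rfl fun y _ => ?_
    rw [Finset.sum_add_distrib, Finset.sum_mul, Finset.sum_mul]
  · refine Finset.sum_eq_zero fun r hr => ?_
    rw [Finset.mem_Ico] at hr
    rw [(hc r p.1 hr.1 hr.2 hp1).2.1 x h, zero_mul]
  · refine Finset.sum_eq_zero fun r hr => ?_
    rw [Finset.mem_Ico] at hr
    rw [(hc r p.2 hr.1 hr.2 hp2).2.1 y h, mul_zero]
  · refine (Finset.abs_sum_le_sum_abs _ _).trans (Finset.sum_le_sum fun r hr => ?_)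
    rw [Finset.mem_Ico] at hr
    rw [abs_mul]
    refine (mul_le_mul ((hc r p.1 hr.1 hr.2 hp1).2.2 x)
      (abs_windowWeight_le hr.1 le_rfl (Nat.le_succ r) hr.2.le hp2) (abs_nonneg _)
      (by split_ifs <;> positivity)).trans_eq ?_
    rw [ite_zero_mul_ite_zero, ← sq, one_div_pow]
  · refine (Finset.abs_sum_le_sum_abs _ _).trans (Finset.sum_le_sum fun r hr => ?_)
    rw [Finset.mem_Ico] at hr
    rw [abs_mul]
    refine (mul_le_mul (abs_windowWeight_le hr.1 (Nat.le_succ r) le_rfl hr.2 hp1)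
      ((hc r p.2 hr.1 hr.2 hp2).2.2 y) (abs_nonneg _)
      (by split_ifs <;> positivity)).trans_eq ?_
    rw [ite_zero_mul_ite_zero, ← sq, one_div_pow]

lemma card_ball_le (k r : ℕ) (hr : 1 ≤ r) (u : ℕ × ℕ) :
    ((((Finset.range k ×ˢ Finset.range k).filter fun p =>
      (u.1 ≤ p.1 + r ∧ p.1 ≤ u.1 + r) ∧ (u.2 ≤ p.2 + r ∧ p.2 ≤ u.2 + r)).card : ℕ) : ℝ) ≤
      9 * (r : ℝ) ^ 2 := by
  have h : ((Finset.range k ×ˢ Finset.range k).filter fun p =>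
      (u.1 ≤ p.1 + r ∧ p.1 ≤ u.1 + r) ∧ (u.2 ≤ p.2 + r ∧ p.2 ≤ u.2 + r)) ⊆
      Finset.Icc (u.1 - r) (u.1 + r) ×ˢ Finset.Icc (u.2 - r) (u.2 + r) := by
    intro p
    simp only [Finset.mem_filter, Finset.mem_product, Finset.mem_Icc]
    omega
  have h2 := Finset.card_le_card h
  rw [Finset.card_product, Nat.card_Icc, Nat.card_Icc] at h2
  have h3 : (u.1 + r + 1 - (u.1 - r)) * (u.2 + r + 1 - (u.2 - r)) ≤ (3 * r) * (3 * r) :=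
    Nat.mul_le_mul (by omega) (by omega)
  have h4 := h2.trans h3
  calc _ ≤ (((3 * r) * (3 * r) : ℕ) : ℝ) := by exact_mod_cast h4
    _ = _ := by push_cast; ring

/-- Expanding the square gives pairs of radii `r, s`. The smaller ball contains at most `9 min(r,
s)²` points, so a pair contributes at most `9 / max(r, s)²`. Summing over the smaller radius leaves
`9 / max(r, s)`, a harmonic sum; the factor 2 is for the order of the pair. -/
lemma sum_flowBound_sq_le (k : ℕ) (u : ℕ × ℕ) :
    ∑ p ∈ Finset.range k ×ˢ Finset.range k, flowBound k p u ^ 2 ≤ 18 * (1 + Real.log k) := by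
  set I : ℕ → ℕ × ℕ → Prop := fun r p =>
    (u.1 ≤ p.1 + r ∧ p.1 ≤ u.1 + r) ∧ (u.2 ≤ p.2 + r ∧ p.2 ≤ u.2 + r) with hI
  have hpair : ∀ r ∈ Finset.Ico 1 k, ∀ s ∈ Finset.Ico 1 k,
      ∑ p ∈ Finset.range k ×ˢ Finset.range k,
        (if I r p then 1 / (r : ℝ) ^ 2 else 0) * (if I s p then 1 / (s : ℝ) ^ 2 else 0) ≤
      (if r ≤ s then 9 / (s : ℝ) ^ 2 else 0) + (if s ≤ r then 9 / (r : ℝ) ^ 2 else 0) := by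
    have key : ∀ r ∈ Finset.Ico 1 k, ∀ s ∈ Finset.Ico 1 k,
        ∑ p ∈ Finset.range k ×ˢ Finset.range k,
        (if I r p then 1 / (r : ℝ) ^ 2 else 0) * (if I s p then 1 / (s : ℝ) ^ 2 else 0) ≤
        9 / (s : ℝ) ^ 2 := by
      intro r hr s hs
      rw [Finset.mem_Ico] at hr hs
      have hr0 : (0 : ℝ) < r := by exact_mod_cast hr.1
      calc _ ≤ ∑ p ∈ Finset.range k ×ˢ Finset.range k,
            (if I r p then 1 / (r : ℝ) ^ 2 else 0) * (1 / (s : ℝ) ^ 2) := by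
            refine Finset.sum_le_sum fun p _ => mul_le_mul_of_nonneg_left ?_ ?_
            · split_ifs
              · exact le_rfl
              · positivity
            · split_ifs <;> positivity
        _ = (((Finset.range k ×ˢ Finset.range k).filter (I r)).card : ℝ) * (1 / (r : ℝ) ^ 2) *
              (1 / (s : ℝ) ^ 2) := by
            rw [← Finset.sum_mul, ← Finset.sum_filter, Finset.sum_const, nsmul_eq_mul]
        _ ≤ 9 * (r : ℝ) ^ 2 * (1 / (r : ℝ) ^ 2) * (1 / (s : ℝ) ^ 2) := by
            gcongr
            exact card_ball_le k r hr.1 u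
        _ = _ := by field_simp
    intro r hr s hs
    rcases le_total r s with h | h
    · refine (key r hr s hs).trans ?_
      rw [if_pos h]
      refine le_add_of_nonneg_right ?_
      split_ifs <;> positivity
    · have := key s hs r hr
      simp only [mul_comm (if I s _ then 1 / (s : ℝ) ^ 2 else 0)] at this
      refine this.trans ?_
      rw [if_pos h]
      refine le_add_of_nonneg_left ?_
      split_ifs <;> positivity
  have hrow : ∀ s ∈ Finset.Ico 1 k, ∑ r ∈ Finset.Ico 1 k, (if r ≤ s then 9 / (s : ℝ) ^ 2 else 0) ≤
      9 * (s : ℝ)⁻¹ := by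
    intro s hs
    rw [Finset.mem_Ico] at hs
    have hs0 : (0 : ℝ) < s := by exact_mod_cast hs.1
    rw [← Finset.sum_filter, Finset.sum_const, nsmul_eq_mul]
    have h1 : ((Finset.Ico 1 k).filter (· ≤ s)).card ≤ s := by
      have : (Finset.Ico 1 k).filter (· ≤ s) ⊆ Finset.Icc 1 s := by
        intro r
        simp only [Finset.mem_filter, Finset.mem_Ico, Finset.mem_Icc]
        omega
      simpa using Finset.card_le_card this
    calc _ ≤ (s : ℝ) * (9 / (s : ℝ) ^ 2) := by
          gcongr
      _ = _ := by field_simp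
  have hharm : ∑ s ∈ Finset.Ico 1 k, (s : ℝ)⁻¹ ≤ 1 + Real.log k := by
    refine le_trans ?_ (harmonic_le_one_add_log k)
    rw [harmonic_eq_sum_Icc]
    push_cast
    refine Finset.sum_le_sum_of_subset_of_nonneg ?_ fun _ _ _ => by positivity
    intro r
    simp only [Finset.mem_Ico, Finset.mem_Icc]
    omega
  calc _ = ∑ p ∈ Finset.range k ×ˢ Finset.range k, ∑ r ∈ Finset.Ico 1 k, ∑ s ∈ Finset.Ico 1 k,
        (if I r p then 1 / (r : ℝ) ^ 2 else 0) * (if I s p then 1 / (s : ℝ) ^ 2 else 0) := by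
        refine Finset.sum_congr rfl fun p _ => ?_
        rw [flowBound, sq, Finset.sum_mul_sum]
    _ = ∑ r ∈ Finset.Ico 1 k, ∑ s ∈ Finset.Ico 1 k, ∑ p ∈ Finset.range k ×ˢ Finset.range k,
        (if I r p then 1 / (r : ℝ) ^ 2 else 0) * (if I s p then 1 / (s : ℝ) ^ 2 else 0) := by
        rw [Finset.sum_comm]
        exact Finset.sum_congr rfl fun r _ => Finset.sum_comm
    _ ≤ ∑ r ∈ Finset.Ico 1 k, ∑ s ∈ Finset.Ico 1 k,
        ((if r ≤ s then 9 / (s : ℝ) ^ 2 else 0) + (if s ≤ r then 9 / (r : ℝ) ^ 2 else 0)) :=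
        Finset.sum_le_sum fun r hr => Finset.sum_le_sum fun s hs => hpair r hr s hs
    _ = 2 * ∑ s ∈ Finset.Ico 1 k, ∑ r ∈ Finset.Ico 1 k, (if r ≤ s then 9 / (s : ℝ) ^ 2 else 0) := by
        simp only [Finset.sum_add_distrib]
        rw [Finset.sum_comm, two_mul]
    _ ≤ 2 * ∑ s ∈ Finset.Ico 1 k, 9 * (s : ℝ)⁻¹ := by
        gcongr with s hs
        exact hrow s hs
    _ = 18 * ∑ s ∈ Finset.Ico 1 k, (s : ℝ)⁻¹ := by
        rw [← Finset.mul_sum]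
        ring
    _ ≤ _ := by gcongr

lemma exists_squareGrid_flow (k : ℕ) :
    ∃ a : Fin k × Fin k → Fin k × Fin k → Fin k × Fin k → ℝ,
      (∀ p (v : Fin k × Fin k → ℝ), v p - (∑ q, v q) / (k : ℝ) ^ 2 =
        ∑ u, ∑ w, a p u w * (v w - v u)) ∧
      (∀ p u w, ¬ (squareGrid k).Adj u w → a p u w = 0) ∧
      ∀ u w, ∑ p, a p u w ^ 2 ≤ 18 * (1 + Real.log k) := by
  choose a b hv ha hb ha' hb' using fun p : Fin k × Fin k =>
    exists_grid_flow_nat (k := k) (p := (p.1.1, p.2.1)) p.1.2 p.2.2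
  refine ⟨fun p u w => (if w.2 = u.2 ∧ w.1.1 = u.1.1 + 1 then a p u.1 u.2 else 0) +
    (if w.1 = u.1 ∧ w.2.1 = u.2.1 + 1 then b p u.1 u.2 else 0), fun p v => ?_, fun p u w h => ?_,
    fun u w => ?_⟩
  -- The extension by zero is harmless, because the coefficients of the edges leaving the grid
  -- vanish.
  · set V : ℕ → ℕ → ℝ := fun x y => if h : x < k ∧ y < k then v (⟨x, h.1⟩, ⟨y, h.2⟩) else 0 with hV
    have hVf : ∀ q : Fin k × Fin k, V q.1 q.2 = v q := fun q => by
      simp [hV]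
    have := hv p V
    rw [hVf p] at this
    simp only [Finset.sum_range] at this
    have e1 : ∑ x : Fin k, ∑ y : Fin k, V x y = ∑ q, v q := by
      rw [Fintype.sum_prod_type]
      exact Finset.sum_congr rfl fun x _ => Finset.sum_congr rfl fun y _ => hVf (x, y)
    rw [e1] at this
    rw [this, Fintype.sum_prod_type]
    refine Finset.sum_congr rfl fun x _ => Finset.sum_congr rfl fun y _ => ?_
    simp only [add_mul, Finset.sum_add_distrib]
    congr 1
    · by_cases hx : x.1 + 1 < k
      · rw [Finset.sum_eq_single (⟨x.1 + 1, hx⟩, y)]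
        · rw [if_pos ⟨rfl, rfl⟩, ← hVf, ← hVf]
        · intro w _ hw
          rw [if_neg, zero_mul]
          rintro ⟨h1, h2⟩
          exact hw (Prod.ext (Fin.ext h2) h1)
        · simp
      · rw [ha p x y (by omega), zero_mul]
        refine (Finset.sum_eq_zero fun w _ => ?_).symm
        rw [ite_self, zero_mul]
    · by_cases hy : y.1 + 1 < k
      · rw [Finset.sum_eq_single (x, ⟨y.1 + 1, hy⟩)]
        · rw [if_pos ⟨rfl, rfl⟩, ← hVf, ← hVf]
        · intro w _ hw
          rw [if_neg, zero_mul]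
          rintro ⟨h1, h2⟩
          exact hw (Prod.ext h1 (Fin.ext h2))
        · simp
      · rw [hb p x y (by omega), zero_mul]
        refine (Finset.sum_eq_zero fun w _ => ?_).symm
        rw [ite_self, zero_mul]
  · simp only [squareGrid, SimpleGraph.boxProd_adj, SimpleGraph.pathGraph_adj, not_or, not_and] at h
    dsimp only
    rw [if_neg, if_neg, add_zero]
    · rintro ⟨h1, h2⟩
      exact h.2 (Or.inl h2.symm) h1.symm
    · rintro ⟨h1, h2⟩
      exact h.1 (Or.inl h2.symm) h1.symm
  · refine le_trans ?_ (sum_flowBound_sq_le k (u.1.1, u.2.1))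
    rw [Finset.sum_product, Finset.sum_range]
    simp only [Finset.sum_range]
    rw [Fintype.sum_prod_type]
    refine Finset.sum_le_sum fun x _ => Finset.sum_le_sum fun y _ => ?_
    rw [sq_le_sq]
    refine le_trans ?_ (le_abs_self _)
    have h0 : 0 ≤ flowBound k (x, y) (u.1.1, u.2.1) := (abs_nonneg _).trans (ha' (x, y) u.1 u.2)
    by_cases h1 : w.2 = u.2 ∧ w.1.1 = u.1.1 + 1
    · rw [if_pos h1, if_neg, add_zero]
      · exact ha' (x, y) _ _
      · rintro ⟨h2, _⟩
        rw [h2] at h1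
        omega
    · rw [if_neg h1, zero_add]
      split_ifs
      · exact hb' (x, y) _ _
      · rwa [abs_zero]

/-! ### Flows on graphs whose components are square grids -/

lemma exists_flow_of_induce_squareGrid {V : Type*} [Fintype V] (H : SimpleGraph V) (s : Set V)
    {k : ℕ} (hk : 1 ≤ k) (φ : H.induce s ≃g squareGrid k) :
    ∃ B : V → V → V → ℝ,
      (∀ p ∈ s, ∀ v : V → ℝ, ∑ q, s.indicator v q = 0 →
        v p = ∑ u, ∑ w, B p u w * (v w - v u)) ∧
      (∀ p u w, B p u w ≠ 0 → p ∈ s ∧ u ∈ s ∧ w ∈ s ∧ H.Adj u w) ∧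
      ∀ u w, ∑ p, B p u w ^ 2 ≤ 27 * Real.log (Fintype.card V) := by
  classical
  obtain ⟨a, hav, haadj, hasq⟩ := exists_squareGrid_flow k
  have : NeZero k := ⟨by omega⟩
  set ψ : Fin k × Fin k → V := fun x => (φ.symm x : V) with hψ
  set θ : V → Fin k × Fin k := fun p => if h : p ∈ s then φ ⟨p, h⟩ else (0, 0) with hθ
  have hψs : ∀ x, ψ x ∈ s := fun x => (φ.symm x).2
  have hθψ : ∀ x, θ (ψ x) = x := fun x => by simp [hθ, hψ]
  have hψθ : ∀ p ∈ s, ψ (θ p) = p := fun p hp => by simp [hθ, hψ, hp]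
  have hinj : Function.Injective ψ := Function.LeftInverse.injective hθψ
  have hrange : ∀ p, p ∉ Set.range ψ → p ∉ s := fun p hp hps => hp ⟨θ p, hψθ p hps⟩
  have hadj : ∀ x y, H.Adj (ψ x) (ψ y) ↔ (squareGrid k).Adj x y := fun x y =>
    φ.symm.map_rel_iff (a := x) (b := y)
  refine ⟨fun p u w => if p ∈ s ∧ u ∈ s ∧ w ∈ s then a (θ p) (θ u) (θ w) else 0,
    fun p hp v hv => ?_, fun p u w h => ?_, fun u w => ?_⟩
  · have h1 := hav (θ p) (v ∘ ψ)
    have h2 : ∑ q, (v ∘ ψ) q = ∑ q, s.indicator v q := by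
      refine Fintype.sum_of_injective ψ hinj _ _ (fun q hq => ?_) fun x => ?_
      · exact Set.indicator_of_notMem (hrange q hq) v
      · exact (Set.indicator_of_mem (hψs x) v).symm
    rw [h2, hv, zero_div, sub_zero, Function.comp_apply, hψθ p hp] at h1
    rw [h1]
    dsimp only
    refine Fintype.sum_of_injective ψ hinj _ _ (fun u hu => ?_) fun x => ?_
    · refine Finset.sum_eq_zero fun w _ => ?_
      rw [if_neg fun h => hrange u hu h.2.1, zero_mul]
    · refine Fintype.sum_of_injective ψ hinj _ _ (fun w hw => ?_) fun y => ?_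
      · rw [if_neg fun h => hrange w hw h.2.2, zero_mul]
      · rw [if_pos ⟨hp, hψs x, hψs y⟩, hθψ, hθψ]
        rfl
  · dsimp only at h
    split_ifs at h with hs
    · refine ⟨hs.1, hs.2.1, hs.2.2, ?_⟩
      rw [← hψθ u hs.2.1, ← hψθ w hs.2.2, hadj]
      by_contra hn
      exact h (haadj _ _ _ hn)
    · exact absurd rfl h
  · have hcard : k ^ 2 ≤ Fintype.card V := by
      simpa [sq] using Fintype.card_le_of_injective ψ hinj
    have hlog0 : 0 ≤ Real.log (Fintype.card V) := Real.log_natCast_nonneg _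
    -- A single vertex has no edges, so the sum is zero. For `k ≥ 2`, `log |V| ≥ 2 log k ≥ 2 log 2 >
    -- 1`, which turns `18 (1 + log k)` into at most `(18 + 9) log |V|`.
    rcases hk.eq_or_lt with rfl | hk2
    · refine (Finset.sum_eq_zero fun p _ => ?_).trans_le (by positivity)
      dsimp only
      rw [haadj _ _ _ fun h => h.ne (Subsingleton.elim _ _), ite_self]
      simp
    · have h1 : ∑ p, (if p ∈ s ∧ u ∈ s ∧ w ∈ s then a (θ p) (θ u) (θ w) else 0) ^ 2 ≤
          ∑ x, a x (θ u) (θ w) ^ 2 := by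
        calc _ ≤ ∑ p, if p ∈ s then a (θ p) (θ u) (θ w) ^ 2 else 0 := by
              refine Finset.sum_le_sum fun p _ => ?_
              split_ifs with h1 h2 h2
              · exact le_rfl
              · exact absurd h1.1 h2
              · simpa using sq_nonneg _
              · simp
          _ = _ := by
              refine (Fintype.sum_of_injective ψ hinj _ _ (fun p hp => ?_) fun x => ?_).symm
              · exact if_neg (hrange p hp)
              · rw [if_pos (hψs x), hθψ]
      refine (h1.trans (hasq _ _)).trans ?_
      have h2 : Real.log 2 ≤ Real.log k :=
        Real.log_le_log (by norm_num) (by exact_mod_cast hk2)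
      have h3 := Real.log_two_gt_d9
      have h4 : 2 * Real.log k ≤ Real.log (Fintype.card V) := by
        have : Real.log ((k : ℝ) ^ 2) ≤ Real.log (Fintype.card V) :=
          Real.log_le_log (by positivity) (by exact_mod_cast hcard)
        rwa [Real.log_pow, Nat.cast_ofNat] at this
      linarith

/-- The flow from `p` stays in the component of `p`. An edge therefore carries flow only from the
points of its own component, and the bound for one component passes to the whole graph without loss.
-/
lemma exists_flow_of_components_squareGrid {V : Type*} [Fintype V] (H : SimpleGraph V)
    (hH : ∀ c : H.ConnectedComponent, ∃ k : ℕ, 1 ≤ k ∧ Nonempty (H.induce c.supp ≃g squareGrid k)) :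
    ∃ A : V → V → V → ℝ,
      (∀ v : V → ℝ, (∀ c : H.ConnectedComponent, ∑ q, c.supp.indicator v q = 0) →
        ∀ p, v p = ∑ u, ∑ w, A p u w * (v w - v u)) ∧
      (∀ p u w, ¬ H.Adj u w → A p u w = 0) ∧
      ∀ u w, ∑ p, A p u w ^ 2 ≤ 27 * Real.log (Fintype.card V) := by
  choose k hk φ using hH
  choose B hBv hBadj hBsq using fun c =>
    exists_flow_of_induce_squareGrid H c.supp (hk c) (φ c).some
  refine ⟨fun p => B (H.connectedComponentMk p) p, fun v hv p => ?_, fun p u w h => ?_,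
    fun u w => ?_⟩
  · exact hBv _ p rfl v (hv _)
  · by_contra hne
    exact h (hBadj _ _ _ _ hne).2.2.2
  · refine le_trans (Finset.sum_le_sum fun p _ => ?_) (hBsq (H.connectedComponentMk u) u w)
    by_cases h0 : B (H.connectedComponentMk p) p u w = 0
    · simpa [h0] using sq_nonneg _
    · have : H.connectedComponentMk u = H.connectedComponentMk p := (hBadj _ _ _ _ h0).2.1
      rw [this]

/-! ### Incidence matrix, total variation and the nullspace of `D_{-S}` -/

namespace DirGraph

variable {n m : ℕ}

lemma incidence_mulVec (G : DirGraph n m) (v : Fin n → ℝ) (i : Fin m) :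
    G.incidence.mulVec v i = v (G.head i) - v (G.tail i) := by
  have h : ∀ j, G.incidence i j * v j =
      (if j = G.head i then v j else 0) - (if j = G.tail i then v j else 0) := by
    intro j
    unfold incidence
    split_ifs with h1 h2 h2
    · exact absurd (h1.symm.trans h2) (G.tail_ne_head i)
    all_goals simp
  simp only [Matrix.mulVec, dotProduct, h, Finset.sum_sub_distrib, Finset.sum_ite_eq',
    Finset.mem_univ, if_true]

lemma underlyingOutside_adj (G : DirGraph n m) (S : Set (Fin m)) {u w : Fin n} :
    (G.underlyingOutside S).Adj u w ↔
      ∃ i ∉ S, (G.tail i = u ∧ G.head i = w) ∨ (G.tail i = w ∧ G.head i = u) := by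
  simp only [underlyingOutside, SimpleGraph.fromRel_adj]
  constructor
  · rintro ⟨_, ⟨i, hi, h⟩ | ⟨i, hi, h⟩⟩
    · exact ⟨i, hi, Or.inl h⟩
    · exact ⟨i, hi, Or.inr h⟩
  · rintro ⟨i, hi, ⟨rfl, rfl⟩ | ⟨rfl, rfl⟩⟩
    · exact ⟨G.tail_ne_head i, Or.inl ⟨i, hi, rfl, rfl⟩⟩
    · exact ⟨(G.tail_ne_head i).symm, Or.inr ⟨i, hi, rfl, rfl⟩⟩

/-- Hölder's inequality between `ℓ^∞` and `ℓ¹`. The factor 2 arises because `c` lives on ordered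
pairs, so each edge is charged in both directions. -/
lemma sum_adj_abs_sub_le (G : DirGraph n m) (S : Set (Fin m)) (c : Fin n → Fin n → ℝ)
    (hc : ∀ u w, ¬ (G.underlyingOutside S).Adj u w → c u w = 0) {τ : ℝ}
    (hτ : ∀ u w, |c u w| ≤ τ) (v : Fin n → ℝ) :
    ∑ u, ∑ w, c u w * (v w - v u) ≤ τ * (2 * normL1 (G.incidence.mulVec v)) := by
  classical
  have h : ∀ u w, c u w * (v w - v u) ≤
      ∑ i, ((if u = G.tail i then if w = G.head i then τ * |v w - v u| else 0 else 0) +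
        (if u = G.head i then if w = G.tail i then τ * |v w - v u| else 0 else 0)) := by
    intro u w
    have hτ0 : 0 ≤ τ := (abs_nonneg _).trans (hτ u w)
    have hnn : ∀ i ∈ Finset.univ, 0 ≤
      (if u = G.tail i then if w = G.head i then τ * |v w - v u| else 0 else 0) +
        (if u = G.head i then if w = G.tail i then τ * |v w - v u| else 0 else 0) := by
      intro i _
      refine add_nonneg ?_ ?_ <;> split_ifs <;> positivity
    by_cases hadj : (G.underlyingOutside S).Adj u w
    · obtain ⟨i, -, hi⟩ := (G.underlyingOutside_adj S).1 hadj
      refine le_trans ?_ (Finset.single_le_sum hnn (Finset.mem_univ i))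
      refine le_trans ((le_abs_self _).trans_eq (abs_mul _ _)) ?_
      refine le_trans (mul_le_mul_of_nonneg_right (hτ u w) (abs_nonneg _)) ?_
      rcases hi with ⟨rfl, rfl⟩ | ⟨rfl, rfl⟩
      · rw [if_pos rfl, if_pos rfl]
        refine le_add_of_nonneg_right ?_
        split_ifs <;> positivity
      · rw [if_pos (rfl : G.head i = G.head i), if_pos rfl]
        refine le_add_of_nonneg_left ?_
        split_ifs <;> positivity
    · rw [hc u w hadj, zero_mul]
      exact Finset.sum_nonneg hnn
  refine (Finset.sum_le_sum fun u _ => Finset.sum_le_sum fun w _ => h u w).trans_eq ?_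
  have hswap : ∀ F : Fin n → Fin n → Fin m → ℝ,
      ∑ u, ∑ w, ∑ i, F u w i = ∑ i, ∑ u, ∑ w, F u w i := by
    intro F
    rw [Finset.sum_comm]
    refine (Finset.sum_congr rfl fun u _ => Finset.sum_comm).trans ?_
    rw [Finset.sum_comm]
    exact Finset.sum_congr rfl fun i _ => Finset.sum_comm
  rw [hswap, normL1, Finset.mul_sum, Finset.mul_sum]
  refine Finset.sum_congr rfl fun i _ => ?_
  simp only [Finset.sum_add_distrib]
  have e1 : ∑ u, ∑ w, (if u = G.tail i then if w = G.head i then τ * |v w - v u| else 0 else 0) =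
      τ * |v (G.head i) - v (G.tail i)| := by
    rw [Finset.sum_eq_single (G.tail i) (by intro b _ hb; simp [hb]) (by simp)]
    simp
  have e2 : ∑ u, ∑ w, (if u = G.head i then if w = G.tail i then τ * |v w - v u| else 0 else 0) =
      τ * |v (G.head i) - v (G.tail i)| := by
    rw [Finset.sum_eq_single (G.head i) (by intro b _ hb; simp [hb]) (by simp)]
    simp [abs_sub_comm]
  rw [e1, e2, incidence_mulVec]
  ring

lemma mem_ker_rowsOutside (G : DirGraph n m) (S : Set (Fin m)) (v : Fin n → ℝ) :
    v ∈ LinearMap.ker (rowsOutside G.incidence S).mulVecLin ↔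
      ∀ u w, (G.underlyingOutside S).Adj u w → v u = v w := by
  have h : v ∈ LinearMap.ker (rowsOutside G.incidence S).mulVecLin ↔
      ∀ i ∉ S, v (G.head i) - v (G.tail i) = 0 := by
    rw [LinearMap.mem_ker, Matrix.mulVecLin_apply, funext_iff]
    constructor
    · intro hv i hi
      rw [← G.incidence_mulVec v i]
      exact hv ⟨i, hi⟩
    · rintro hv ⟨i, hi⟩
      have := hv i hi
      rw [← G.incidence_mulVec v i] at this
      exact this
  rw [h]
  constructor
  · intro hv u w hadj
    obtain ⟨i, hi, ⟨rfl, rfl⟩ | ⟨rfl, rfl⟩⟩ := (G.underlyingOutside_adj S).1 hadj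
    · linarith [hv i hi]
    · linarith [hv i hi]
  · intro hv i hi
    linarith [hv _ _ ((G.underlyingOutside_adj S).2 ⟨i, hi, Or.inl ⟨rfl, rfl⟩⟩)]

lemma indicator_supp_mem_ker (G : DirGraph n m) (S : Set (Fin m))
    (c : (G.underlyingOutside S).ConnectedComponent) :
    c.supp.indicator (fun _ => (1 : ℝ)) ∈
      LinearMap.ker (rowsOutside G.incidence S).mulVecLin := by
  classical
  rw [mem_ker_rowsOutside]
  intro u w h
  have : u ∈ c.supp ↔ w ∈ c.supp := by
    simp only [SimpleGraph.ConnectedComponent.mem_supp_iff,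
      SimpleGraph.ConnectedComponent.connectedComponentMk_eq_of_adj h]
  simp only [Set.indicator_apply, this]

end DirGraph

/-! ### Gaussian tail bounds -/

lemma isotropicGaussian_eq_map (n : ℕ) (σ : ℝ) :
    isotropicGaussian n σ =
      (Measure.pi fun _ : Fin n => gaussianReal 0 1).map fun z i => σ * z i := by
  rw [isotropicGaussian]
  have h1 : (gaussianReal 0 1).map (fun x => σ * x) = gaussianReal 0 (σ ^ 2).toNNReal := by
    rw [gaussianReal_map_const_mul, mul_zero, mul_one]
    congr 1
    ext
    simp [sq_nonneg]
  have : ∀ i : Fin n, SigmaFinite ((gaussianReal 0 1).map (fun x => σ * x)) := fun i => by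
    rw [h1]
    infer_instance
  have h := Measure.pi_map_pi (μ := fun _ : Fin n => gaussianReal 0 1)
    (f := fun _ x => σ * x) (fun i => by fun_prop)
  rw [h]
  simp only [h1]

lemma hasSubgaussianMGF_id_gaussianReal : HasSubgaussianMGF id 1 (gaussianReal 0 1) where
  integrable_exp_mul t := integrable_exp_mul_gaussianReal t
  mgf_le t := by
    rw [mgf_gaussianReal Measure.map_id]
    simp

lemma pi_gaussianReal_abs_linear_tail {n : ℕ} (a : Fin n → ℝ) {V τ : ℝ} (hV : 0 < V)
    (ha : ∑ p, a p ^ 2 ≤ V) (hτ : 0 ≤ τ) :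
    (Measure.pi fun _ : Fin n => gaussianReal 0 1).real {z | τ < |∑ p, a p * z p|} ≤
      2 * Real.exp (-τ ^ 2 / (2 * V)) := by
  set γ : Measure (Fin n → ℝ) := Measure.pi fun _ : Fin n => gaussianReal 0 1 with hγ
  have hind : ∀ b : Fin n → ℝ, iIndepFun (fun p (z : Fin n → ℝ) => b p * z p) γ := fun b =>
      iIndepFun_pi (X := fun p x => b p * x) (fun p => by fun_prop)
  have h2 : ∀ p, HasSubgaussianMGF (fun z : Fin n → ℝ => z p) 1 γ := by
    intro p
    refine HasSubgaussianMGF.of_map (Y := fun z : Fin n → ℝ => z p) (X := id)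
      (measurable_pi_apply p).aemeasurable ?_
    rw [hγ, (measurePreserving_eval (fun _ : Fin n => gaussianReal 0 1) p).map_eq]
    exact hasSubgaussianMGF_id_gaussianReal
  have hsum : HasSubgaussianMGF (fun z : Fin n → ℝ => ∑ p, a p * z p) V.toNNReal γ := by
    have h3 := HasSubgaussianMGF.sum_of_iIndepFun (hind a) (s := Finset.univ)
      (fun p _ => (h2 p).const_mul (a p))
    -- The exact variance proxy `∑ a p ^ 2` is enlarged to `V`.
    refine ⟨h3.integrable_exp_mul, fun t => (h3.mgf_le t).trans (Real.exp_le_exp.2 ?_)⟩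
    rw [Real.coe_toNNReal _ hV.le]
    have h4 : ((∑ p, (⟨a p ^ 2, sq_nonneg (a p)⟩ * 1 : NNReal) : NNReal) : ℝ) = ∑ p, a p ^ 2 := by
      rw [NNReal.coe_sum]
      exact Finset.sum_congr rfl fun p _ => (NNReal.coe_mul _ _).trans (mul_one _)
    rw [h4]
    gcongr
  have e : ((V.toNNReal : NNReal) : ℝ) = V := Real.coe_toNNReal _ hV.le
  have hp := hsum.measure_ge_le hτ
  have hm := hsum.neg.measure_ge_le hτ
  rw [e] at hp hm
  have hsub : {z : Fin n → ℝ | τ < |∑ p, a p * z p|} ⊆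
      {z | τ ≤ ∑ p, a p * z p} ∪ {z | τ ≤ (-fun z : Fin n → ℝ => ∑ p, a p * z p) z} := by
    intro z hz
    rcases lt_abs.1 (show τ < |∑ p, a p * z p| from hz) with h | h
    · exact Or.inl h.le
    · exact Or.inr h.le
  refine (measureReal_mono hsub).trans ((measureReal_union_le _ _).trans ?_)
  linarith

/-! ### Chi-square tails and rotation invariance -/

lemma integral_exp_mul_sq_gaussianReal {s : ℝ} (hs : s < 1 / 2) :
    ∫ x, Real.exp (s * x ^ 2) ∂gaussianReal 0 1 = (√(1 - 2 * s))⁻¹ := by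
  rw [integral_gaussianReal_eq_integral_smul one_ne_zero]
  have h : ∀ x : ℝ, gaussianPDFReal 0 1 x • Real.exp (s * x ^ 2) =
      (√(2 * Real.pi))⁻¹ * Real.exp (-(1 / 2 - s) * x ^ 2) := by
    intro x
    simp only [gaussianPDFReal, NNReal.coe_one, mul_one, sub_zero, smul_eq_mul]
    rw [mul_assoc, ← Real.exp_add]
    congr 2
    ring
  simp only [h]
  rw [integral_const_mul, integral_gaussian, ← Real.sqrt_inv, ← Real.sqrt_mul (by positivity),
    ← Real.sqrt_inv]
  congr 1
  have : 1 - 2 * s ≠ 0 := by linarith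
  have h3 : 1 / 2 - s ≠ 0 := by linarith
  have := Real.pi_pos.ne'
  field_simp

lemma integrable_exp_mul_sq_gaussianReal {s : ℝ} (hs : s < 1 / 2) :
    Integrable (fun x => Real.exp (s * x ^ 2)) (gaussianReal 0 1) := by
  -- The integral of a non-integrable function is zero by convention, so a nonzero value forces
  -- integrability.
  refine not_imp_comm.1 integral_undef ?_
  rw [integral_exp_mul_sq_gaussianReal hs]
  have : 0 < √(1 - 2 * s) := Real.sqrt_pos.2 (by linarith)
  positivity

/-- Chernoff's bound. With `c = √(2x)` and `b = √r`, the moment generating function is `(1 + c/b)^r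
≤ exp(cb)`, and the exponent `-c²/2 - cb` from the threshold leaves exactly `exp(-x)`. The case `r =
0` is separate because of the division by `b`. -/
lemma pi_gaussianReal_sum_sq_tail (r : ℕ) {x : ℝ} (hx : 0 < x) :
    (Measure.pi fun _ : Fin r => gaussianReal 0 1).real
      {z | (√(2 * x) + √(r : ℝ)) ^ 2 < ∑ i, z i ^ 2} ≤ Real.exp (-x) := by
  rcases Nat.eq_zero_or_pos r with rfl | hr
  · have : {z : Fin 0 → ℝ | (√(2 * x) + √((0 : ℕ) : ℝ)) ^ 2 < ∑ i, z i ^ 2} = ∅ := by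
      ext z
      simp only [Finset.univ_eq_empty, Finset.sum_empty, Set.mem_ofPred_eq, Set.mem_empty_iff_false,
        iff_false, not_lt]
      positivity
    rw [this, measureReal_empty]
    positivity
  · set γ : Measure (Fin r → ℝ) := Measure.pi fun _ => gaussianReal 0 1
    have hr0 : (0 : ℝ) < r := by exact_mod_cast hr
    set b := √(r : ℝ) with hb
    set c := √(2 * x) with hc
    have hb0 : 0 < b := Real.sqrt_pos.2 hr0
    have hc0 : 0 < c := Real.sqrt_pos.2 (by linarith)
    have hb2 : b ^ 2 = r := Real.sq_sqrt hr0.le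
    have hc2 : c ^ 2 = 2 * x := Real.sq_sqrt (by linarith)
    -- The optimal Chernoff parameter for the threshold `(c + b)²`; it makes `1 - 2s` the square `(b
    -- / (c + b))²`.
    set s : ℝ := (1 - b ^ 2 / (c + b) ^ 2) / 2 with hs
    have hq : b ^ 2 / (c + b) ^ 2 ≤ 1 := by
      rw [div_le_one (by positivity)]
      nlinarith
    have hq0 : 0 < b ^ 2 / (c + b) ^ 2 := by positivity
    have hs0 : 0 ≤ s := by linarith
    have hs2 : s < 1 / 2 := by linarith
    have h12 : (√(1 - 2 * s))⁻¹ = 1 + c / b := by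
      have : 1 - 2 * s = (b / (c + b)) ^ 2 := by
        rw [hs, div_pow]
        ring
      rw [this, Real.sqrt_sq (by positivity)]
      field_simp
      ring
    have hexp : ∀ z : Fin r → ℝ, Real.exp (s * ∑ i, z i ^ 2) = ∏ i, Real.exp (s * z i ^ 2) := by
      intro z
      rw [Finset.mul_sum, Real.exp_sum]
    have hint : Integrable (fun z : Fin r → ℝ => Real.exp (s * ∑ i, z i ^ 2)) γ := by
      simp only [hexp]
      exact Integrable.fintype_prod (f := fun _ x => Real.exp (s * x ^ 2))
        fun _ => integrable_exp_mul_sq_gaussianReal hs2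
    have hmgf : mgf (fun z : Fin r → ℝ => ∑ i, z i ^ 2) γ s = (1 + c / b) ^ r := by
      simp only [mgf, hexp]
      rw [integral_fintype_prod_eq_prod (f := fun _ x => Real.exp (s * x ^ 2))]
      simp only [integral_exp_mul_sq_gaussianReal hs2, h12, Finset.prod_const, Finset.card_univ,
        Fintype.card_fin]
    have hch := measure_ge_le_exp_mul_mgf ((c + b) ^ 2) hs0 hint
    rw [hmgf] at hch
    have hsub : {z : Fin r → ℝ | (c + b) ^ 2 < ∑ i, z i ^ 2} ⊆ {z | (c + b) ^ 2 ≤ ∑ i, z i ^ 2} := by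
      intro z hz
      simp only [Set.mem_ofPred_eq] at *
      exact hz.le
    refine (measureReal_mono hsub).trans (hch.trans ?_)
    have h1 : (1 + c / b) ^ r ≤ Real.exp (c * b) := by
      calc (1 + c / b) ^ r ≤ Real.exp (c / b) ^ r := by
            gcongr
            linarith [Real.add_one_le_exp (c / b)]
        _ = Real.exp (c * b) := by
            rw [← Real.exp_nat_mul, ← hb2]
            congr 1
            field_simp
    calc _ ≤ Real.exp (-s * (c + b) ^ 2) * Real.exp (c * b) := by gcongr
      _ = Real.exp (-x) := by
        rw [← Real.exp_add]
        congr 1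
        have : s * (c + b) ^ 2 = ((c + b) ^ 2 - b ^ 2) / 2 := by
          rw [hs]
          field_simp
        have h3 : x = c ^ 2 / 2 := by linarith
        rw [neg_mul, this, h3]
        ring

/-- The characteristic function of the image at `t` is that of the standard Gaussian at `∑ i, t i •
b i`, a vector with the same norm as `t`. -/
lemma pi_gaussianReal_map_orthonormal {n r : ℕ} (b : Fin r → EuclideanSpace ℝ (Fin n))
    (hb : Orthonormal ℝ b) :
    (Measure.pi fun _ : Fin n => gaussianReal 0 1).map (fun z i => ∑ p, b i p * z p) =
      Measure.pi fun _ : Fin r => gaussianReal 0 1 := by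
  have hmeas : Measurable fun (z : Fin n → ℝ) (i : Fin r) => ∑ p, b i p * z p := by fun_prop
  have key : ((Measure.pi fun _ : Fin n => gaussianReal 0 1).map
      (fun z i => ∑ p, b i p * z p)).map (WithLp.toLp 2) =
      stdGaussian (EuclideanSpace ℝ (Fin r)) := by
    have : IsFiniteMeasure (((Measure.pi fun _ : Fin n => gaussianReal 0 1).map
      (fun z i => ∑ p, b i p * z p)).map (WithLp.toLp 2)) := by infer_instance
    apply Measure.ext_of_charFun
    ext t
    have h1 := charFun_stdGaussian (∑ i, t i • b i)
    rw [← map_pi_eq_stdGaussian, charFun_apply, integral_map (by fun_prop) (by fun_prop)] at h1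
    have hn : ‖∑ i, t i • b i‖ = ‖t‖ := by
      rw [← sq_eq_sq₀ (norm_nonneg _) (norm_nonneg _)]
      rw [← real_inner_self_eq_norm_sq, hb.inner_sum, EuclideanSpace.real_norm_sq_eq]
      simp [sq]
    rw [charFun_stdGaussian, ← hn, ← h1, charFun_apply, Measure.map_map (by fun_prop) hmeas,
      integral_map (Measurable.comp (by fun_prop) hmeas).aemeasurable (by fun_prop)]
    congr 1
    ext z
    congr 3
    rw [inner_sum]
    simp only [Function.comp_apply, PiLp.inner_apply, inner_smul_right, RCLike.inner_apply,
      conj_trivial]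
  have h2 := congrArg (Measure.map (WithLp.ofLp)) (key.trans map_pi_eq_stdGaussian.symm)
  have h3 : ∀ μ : Measure (Fin r → ℝ),
      (μ.map (WithLp.toLp 2)).map (WithLp.ofLp : EuclideanSpace ℝ (Fin r) → Fin r → ℝ) = μ := by
    intro μ
    rw [Measure.map_map (by fun_prop) (by fun_prop)]
    exact Measure.map_id
  rwa [h3, h3] at h2

lemma pi_gaussianReal_orthonormal_tail {n r : ℕ} (b : Fin r → EuclideanSpace ℝ (Fin n))
    (hb : Orthonormal ℝ b) {x : ℝ} (hx : 0 < x) :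
    (Measure.pi fun _ : Fin n => gaussianReal 0 1).real
      {z | (√(2 * x) + √(r : ℝ)) ^ 2 < ∑ i, (∑ p, b i p * z p) ^ 2} ≤ Real.exp (-x) := by
  have h := pi_gaussianReal_sum_sq_tail r hx
  rw [← pi_gaussianReal_map_orthonormal b hb, map_measureReal_apply (by fun_prop)] at h
  · exact h
  · exact measurableSet_lt (by fun_prop) (by fun_prop)

/-! ### The deterministic oracle inequality -/

lemma normL1_add_le {m : ℕ} (v w : Fin m → ℝ) : normL1 (v + w) ≤ normL1 v + normL1 w := by
  rw [normL1, normL1, normL1, ← Finset.sum_add_distrib]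
  exact Finset.sum_le_sum fun i _ => abs_add_le (v i) (w i)

lemma normL1_smul {m : ℕ} (c : ℝ) (v : Fin m → ℝ) : normL1 (c • v) = |c| * normL1 v := by
  simp only [normL1, Pi.smul_apply, smul_eq_mul, abs_mul, Finset.mul_sum]

lemma normL1_sub_le {m : ℕ} (v w : Fin m → ℝ) : normL1 (v - w) ≤ normL1 v + normL1 w := by
  rw [normL1, normL1, normL1, ← Finset.sum_add_distrib]
  exact Finset.sum_le_sum fun i _ => abs_sub (v i) (w i)

lemma normSqN_nonneg {n : ℕ} (v : Fin n → ℝ) : 0 ≤ normSqN v :=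
  div_nonneg (Finset.sum_nonneg fun _ _ => sq_nonneg _) (Nat.cast_nonneg _)

lemma normSqN_sub_smul {n : ℕ} (v w : Fin n → ℝ) (s : ℝ) :
    normSqN (v - s • w) = normSqN v - 2 * s * ((∑ i, v i * w i) / n) + s ^ 2 * normSqN w := by
  have h : ∑ i, (v - s • w) i ^ 2 =
      ∑ i, v i ^ 2 - 2 * s * (∑ i, v i * w i) + s ^ 2 * ∑ i, w i ^ 2 := by
    rw [Finset.mul_sum, Finset.mul_sum, ← Finset.sum_sub_distrib, ← Finset.sum_add_distrib]
    refine Finset.sum_congr rfl fun i _ => ?_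
    simp only [Pi.sub_apply, Pi.smul_apply, smul_eq_mul]
    ring
  simp only [normSqN, h]
  ring

lemma normSqN_sub {n : ℕ} (v w : Fin n → ℝ) :
    normSqN (v - w) = normSqN v - 2 * ((∑ i, v i * w i) / n) + normSqN w := by
  simpa using normSqN_sub_smul v w 1

/-- The minimiser is compared with `g + s(f - g)` for small `s > 0`: dividing by `s` and letting `s`
tend to zero gives the first order condition `0 ≤ B`. Since the loss is exactly quadratic, this
yields the additional term `‖g - f‖²ₙ`. -/
lemma IsAnalysisEstimator.strong_ineq {m n : ℕ} {D : Matrix (Fin m) (Fin n) ℝ} {lam : ℝ}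
    {y g : Fin n → ℝ} (hg : IsAnalysisEstimator D lam y g) (hlam : 0 ≤ lam) (f : Fin n → ℝ) :
    normSqN (y - g) + normSqN (g - f) + 2 * lam * normL1 (D.mulVec g) ≤
      normSqN (y - f) + 2 * lam * normL1 (D.mulVec f) := by
  set Q := (∑ i, (y - g) i * (f - g) i) / n with hQ
  set R := normSqN (f - g) with hR
  set B := -2 * Q + 2 * lam * (normL1 (D.mulVec f) - normL1 (D.mulVec g)) with hB
  have hR0 : 0 ≤ R := normSqN_nonneg _
  have key : ∀ s : ℝ, 0 < s → s ≤ 1 → 0 ≤ B + s * R := by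
    intro s hs hs1
    have h1 := hg (g + s • (f - g))
    have h2 : y - (g + s • (f - g)) = (y - g) - s • (f - g) := by abel
    have h3 : normL1 (D.mulVec (g + s • (f - g))) ≤
        (1 - s) * normL1 (D.mulVec g) + s * normL1 (D.mulVec f) := by
      have : D.mulVec (g + s • (f - g)) = (1 - s) • D.mulVec g + s • D.mulVec f := by
        rw [Matrix.mulVec_add, Matrix.mulVec_smul, Matrix.mulVec_sub, sub_smul, smul_sub, one_smul]
        abel
      rw [this]
      refine (normL1_add_le _ _).trans_eq ?_
      rw [normL1_smul, normL1_smul, abs_of_nonneg hs.le, abs_of_nonneg (by linarith)]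
    rw [h2, normSqN_sub_smul] at h1
    have h4 := mul_le_mul_of_nonneg_left h3 (by linarith : 0 ≤ 2 * lam)
    have h5 : 0 ≤ s * (B + s * R) := by
      rw [hB]
      nlinarith
    exact nonneg_of_mul_nonneg_right h5 hs
  have hB0 : 0 ≤ B := by
    by_contra hneg
    push Not at hneg
    have hden : 0 < R - B + 1 := by linarith
    -- If `B < 0`, this step length lies in `(0, 1]` and makes `B + s * R` negative.
    have h := key (-B / (R - B + 1)) (div_pos (by linarith) hden)
      (by rw [div_le_one hden]; linarith)
    have h6 : B + -B / (R - B + 1) * R = B * (1 - B) / (R - B + 1) := by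
      field_simp
      ring
    rw [h6] at h
    have : B * (1 - B) / (R - B + 1) < 0 := div_neg_of_neg_of_pos (by nlinarith) hden
    linarith
  have e1 : normSqN (y - f) = normSqN (y - g) - 2 * Q + R := by
    rw [← normSqN_sub]
    congr 1
    abel
  have e2 : normSqN (g - f) = R := by
    rw [hR, normSqN, normSqN]
    congr 1
    exact Finset.sum_congr rfl fun i _ => by simp only [Pi.sub_apply]; ring
  rw [e1, e2]
  linarith

lemma IsAnalysisEstimator.basic_ineq {m n : ℕ} {D : Matrix (Fin m) (Fin n) ℝ} {lam : ℝ}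
    {f₀ e g : Fin n → ℝ} (hg : IsAnalysisEstimator D lam (f₀ + e) g) (hlam : 0 ≤ lam)
    (f : Fin n → ℝ) :
    normSqN (g - f₀) + normSqN (g - f) ≤
      normSqN (f - f₀) + 2 * ((∑ i, e i * (g - f) i) / n) +
        2 * lam * (normL1 (D.mulVec f) - normL1 (D.mulVec g)) := by
  have h := hg.strong_ineq hlam f
  have e1 : ∀ v : Fin n → ℝ, normSqN (f₀ + e - v) =
      normSqN e - 2 * ((∑ i, e i * (v - f₀) i) / n) + normSqN (v - f₀) := by
    intro v
    rw [← normSqN_sub]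
    congr 1
    abel
  have e2 : (∑ i, e i * (g - f) i) / n =
      (∑ i, e i * (g - f₀) i) / n - (∑ i, e i * (f - f₀) i) / n := by
    rw [← sub_div, ← Finset.sum_sub_distrib]
    congr 1
    exact Finset.sum_congr rfl fun i _ => by simp only [Pi.sub_apply]; ring
  rw [e1, e1] at h
  rw [e2]
  linarith

/-! ### Projection onto the nullspace and decomposition of the noise -/

lemma exists_orthonormal_projection {n : ℕ} (N : Submodule ℝ (Fin n → ℝ)) :
    ∃ b : Fin (Module.finrank ℝ N) → EuclideanSpace ℝ (Fin n),
      Orthonormal ℝ b ∧ (∀ i, (fun p => b i p) ∈ N) ∧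
      ∀ v : Fin n → ℝ, ∀ w ∈ N,
        ∑ p, (v p - ∑ i, (∑ q, b i q * v q) * b i p) * w p = 0 := by
  set e := (WithLp.linearEquiv 2 ℝ (Fin n → ℝ)).symm with he
  set N' : Submodule ℝ (EuclideanSpace ℝ (Fin n)) := N.map e.toLinearMap with hN'
  have hrank : Module.finrank ℝ N' = Module.finrank ℝ N := LinearEquiv.finrank_map_eq e N
  set β := (stdOrthonormalBasis ℝ N').reindex (finCongr hrank) with hβ
  have hmem : ∀ u ∈ N', (fun p => u p) ∈ N := by
    rintro u ⟨x, hx, rfl⟩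
    exact hx
  refine ⟨fun i => (β i : EuclideanSpace ℝ (Fin n)),
    β.orthonormal.comp_linearIsometry N'.subtypeₗᵢ, fun i => hmem _ (β i).2, fun v w hw => ?_⟩
  have hw' : WithLp.toLp 2 w ∈ N' := ⟨w, hw, rfl⟩
  have h1 := congrArg Subtype.val (β.sum_repr' ⟨WithLp.toLp 2 w, hw'⟩)
  have h2 : ∀ p, w p = ∑ i, (∑ q, (β i : EuclideanSpace ℝ (Fin n)) q * w q) *
      (β i : EuclideanSpace ℝ (Fin n)) p := by
    intro p
    have h3 := congrArg (fun u : EuclideanSpace ℝ (Fin n) => u p) h1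
    simp only [Submodule.coe_sum, Submodule.coe_smul, Submodule.coe_inner, PiLp.inner_apply,
      RCLike.inner_apply, conj_trivial, WithLp.ofLp_sum, Finset.sum_apply, WithLp.ofLp_smul,
      Pi.smul_apply, smul_eq_mul] at h3
    rw [← h3]
    refine Finset.sum_congr rfl fun i _ => ?_
    congr 1
    exact Finset.sum_congr rfl fun q _ => mul_comm _ _
  simp only [sub_mul, Finset.sum_sub_distrib]
  rw [sub_eq_zero]
  calc ∑ p, v p * w p = ∑ p, ∑ i, (∑ q, (β i : EuclideanSpace ℝ (Fin n)) q * w q) *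
        ((β i : EuclideanSpace ℝ (Fin n)) p * v p) := by
        refine Finset.sum_congr rfl fun p _ => ?_
        conv_lhs => rw [h2 p]
        rw [Finset.mul_sum]
        exact Finset.sum_congr rfl fun i _ => by ring
    _ = ∑ i, (∑ q, (β i : EuclideanSpace ℝ (Fin n)) q * w q) *
        ∑ p, (β i : EuclideanSpace ℝ (Fin n)) p * v p := by
        rw [Finset.sum_comm]
        exact Finset.sum_congr rfl fun i _ => (Finset.mul_sum _ _ _).symm
    _ = ∑ i, (∑ p, (β i : EuclideanSpace ℝ (Fin n)) p * v p) *
        ∑ q, (β i : EuclideanSpace ℝ (Fin n)) q * w q :=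
        Finset.sum_congr rfl fun i _ => mul_comm _ _
    _ = _ := by
        simp only [Finset.mul_sum]
        rw [Finset.sum_comm]
        refine Finset.sum_congr rfl fun p _ => ?_
        rw [Finset.sum_mul]
        exact Finset.sum_congr rfl fun i _ => by ring

namespace DirGraph

variable {n m : ℕ}

lemma exists_noise_decomposition (G : DirGraph n m) (S : Set (Fin m)) (hS : G.ComponentsSquare S) :
    ∃ (b : Fin (nullDim G.incidence S) → EuclideanSpace ℝ (Fin n))
      (A : Fin n → Fin n → Fin n → ℝ), Orthonormal ℝ b ∧
      (∀ u w, ∑ p, A p u w ^ 2 ≤ 27 * Real.log n) ∧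
      ∀ (e h : Fin n → ℝ) (τ : ℝ), (∀ u w, |∑ p, A p u w * e p| ≤ τ) →
        2 * ∑ p, e p * h p ≤ ∑ p, h p ^ 2 + ∑ i, (∑ p, b i p * e p) ^ 2 +
          4 * τ * normL1 (G.incidence.mulVec h) := by
  set N := LinearMap.ker (rowsOutside G.incidence S).mulVecLin with hN
  obtain ⟨b, hb, hbN, hbproj⟩ := exists_orthonormal_projection N
  obtain ⟨A, hAv, hAadj, hAsq⟩ := exists_flow_of_components_squareGrid (G.underlyingOutside S) hS
  refine ⟨b, A, hb, fun u w => by simpa using hAsq u w, fun e h τ hτ => ?_⟩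
  set c : Fin (Module.finrank ℝ N) → ℝ := fun i => ∑ q, b i q * h q with hc
  set d : Fin (Module.finrank ℝ N) → ℝ := fun i => ∑ q, b i q * e q with hd
  set h' : Fin n → ℝ := fun p => h p - ∑ i, c i * b i p with hh'
  have horth : ∀ w ∈ N, ∑ p, h' p * w p = 0 := hbproj h
  have hzero : ∀ C : (G.underlyingOutside S).ConnectedComponent,
      ∑ q, C.supp.indicator h' q = 0 := by
    intro C
    rw [← horth _ (G.indicator_supp_mem_ker S C)]
    refine Finset.sum_congr rfl fun q _ => ?_
    by_cases hq : q ∈ C.supp <;> simp [hq]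
  -- The projection onto `N` is constant along the edges outside `S`, so the flow, which uses only
  -- those edges, sees `h` itself.
  have hdiff : ∀ u w, (G.underlyingOutside S).Adj u w → h' w - h' u = h w - h u := by
    intro u w huw
    have : ∑ i, c i * b i u = ∑ i, c i * b i w := by
      refine Finset.sum_congr rfl fun i _ => ?_
      rw [(G.mem_ker_rowsOutside S _).1 (hbN i) u w huw]
    simp only [hh', this]
    ring
  have hflow : ∑ p, e p * h' p ≤ τ * (2 * normL1 (G.incidence.mulVec h)) := by
    have e1 : ∑ p, e p * h' p = ∑ u, ∑ w, (∑ p, A p u w * e p) * (h w - h u) := by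
      calc _ = ∑ p, ∑ u, ∑ w, A p u w * e p * (h w - h u) := by
            refine Finset.sum_congr rfl fun p _ => ?_
            rw [hAv h' hzero p, Finset.mul_sum]
            refine Finset.sum_congr rfl fun u _ => ?_
            rw [Finset.mul_sum]
            refine Finset.sum_congr rfl fun w _ => ?_
            by_cases huw : (G.underlyingOutside S).Adj u w
            · rw [hdiff u w huw]
              ring
            · simp [hAadj p u w huw]
        _ = _ := by
            rw [Finset.sum_comm]
            refine Finset.sum_congr rfl fun u _ => ?_
            rw [Finset.sum_comm]
            exact Finset.sum_congr rfl fun w _ => (Finset.sum_mul _ _ _).symm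
    rw [e1]
    refine G.sum_adj_abs_sub_le S _ (fun u w huw => ?_) hτ h
    exact Finset.sum_eq_zero fun p _ => by rw [hAadj p u w huw, zero_mul]
  have hsplit : ∑ p, e p * h p = ∑ p, e p * h' p + ∑ i, c i * d i := by
    have : ∑ i, c i * d i = ∑ p, e p * ∑ i, c i * b i p := by
      simp only [hd, Finset.mul_sum]
      rw [Finset.sum_comm]
      exact Finset.sum_congr rfl fun p _ => Finset.sum_congr rfl fun i _ => by ring
    rw [this, ← Finset.sum_add_distrib]
    exact Finset.sum_congr rfl fun p _ => by simp only [hh']; ring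
  have hbessel : ∑ i, c i ^ 2 ≤ ∑ p, h p ^ 2 := by
    have h1 : ∑ p, h' p * (∑ i, c i * b i p) = 0 := by
      refine horth (fun p => ∑ i, c i * b i p) ?_
      have : (fun p => ∑ i, c i * b i p) = ∑ i, c i • fun p => b i p := by
        ext p
        simp
      rw [this]
      exact N.sum_mem fun i _ => N.smul_mem _ (hbN i)
    have h2 : ∑ p, h p * (∑ i, c i * b i p) = ∑ i, c i ^ 2 := by
      simp only [Finset.mul_sum]
      rw [Finset.sum_comm]
      refine Finset.sum_congr rfl fun i _ => ?_
      calc _ = c i * ∑ q, b i q * h q := by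
            rw [Finset.mul_sum]
            exact Finset.sum_congr rfl fun q _ => by ring
        _ = _ := (sq (c i)).symm
    have h3 : ∑ p, h p ^ 2 - ∑ p, h p * (∑ i, c i * b i p) =
        ∑ p, h' p ^ 2 + ∑ p, h' p * (∑ i, c i * b i p) := by
      rw [← Finset.sum_sub_distrib, ← Finset.sum_add_distrib]
      exact Finset.sum_congr rfl fun p _ => by simp only [hh']; ring
    have h4 : 0 ≤ ∑ p, h' p ^ 2 := Finset.sum_nonneg fun _ _ => sq_nonneg _
    linarith
  have hyoung : 2 * ∑ i, c i * d i ≤ ∑ i, c i ^ 2 + ∑ i, d i ^ 2 := by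
    rw [Finset.mul_sum, ← Finset.sum_add_distrib]
    exact Finset.sum_le_sum fun i _ => by linarith [two_mul_le_add_sq (c i) (d i)]
  change _ ≤ ∑ p, h p ^ 2 + ∑ i, d i ^ 2 + _
  linarith

end DirGraph

/-! ### The oracle inequality with high probability -/

lemma gridLevel_nonneg {n : ℕ} {σ t : ℝ} (hσ : 0 ≤ σ) : 0 ≤ gridLevel n σ t :=
  mul_nonneg (div_nonneg hσ (Nat.cast_nonneg _)) (Real.sqrt_nonneg _)

/-- The exponent is `(C/2)² / (2 * 27) = C² / 216` times `log (2n) + t`, and `26² / 216 > 3`: this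
is the origin of the constant 26. For `n = 1` all coefficients vanish and the event is empty. -/
lemma pi_gaussianReal_flow_tail {n : ℕ} (hn : 1 ≤ n) {a : Fin n → ℝ}
    (ha : ∑ p, a p ^ 2 ≤ 27 * Real.log n) {C t : ℝ} (hC : 26 ≤ C) (ht : 0 < t) :
    (Measure.pi fun _ : Fin n => gaussianReal 0 1).real
      {z | C / 2 * √(Real.log n * (Real.log (2 * n) + t)) < |∑ p, a p * z p|} ≤
      2 * Real.exp (-(3 * (Real.log (2 * n) + t))) := by
  have hn0 : (1 : ℝ) ≤ n := by exact_mod_cast hn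
  have hL : 0 < Real.log (2 * n) + t := by
    have : 0 ≤ Real.log (2 * n) := Real.log_nonneg (by linarith)
    linarith
  rcases (Real.log_natCast_nonneg n).eq_or_lt with h0 | hpos
  · have ha0 : ∀ p, a p = 0 := by
      rw [← h0, mul_zero] at ha
      have h := (Finset.sum_eq_zero_iff_of_nonneg fun p _ => sq_nonneg (a p)).1
        (le_antisymm ha (Finset.sum_nonneg fun p _ => sq_nonneg (a p)))
      exact fun p => pow_eq_zero_iff two_ne_zero |>.1 (h p (Finset.mem_univ p))
    have : {z : Fin n → ℝ | C / 2 * √(Real.log n * (Real.log (2 * n) + t)) <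
        |∑ p, a p * z p|} = ∅ := by
      ext z
      simp [ha0, ← h0]
    rw [this, measureReal_empty]
    positivity
  · refine (pi_gaussianReal_abs_linear_tail a (by positivity) ha (by positivity)).trans ?_
    gcongr
    rw [neg_div, neg_le_neg_iff, le_div_iff₀ (by positivity), mul_pow,
      Real.sq_sqrt (by positivity)]
    have : 0 < Real.log n * (Real.log (2 * n) + t) := by positivity
    nlinarith [mul_le_mul hC hC (by norm_num) (by linarith)]

/-- The union bound over the `n²` pairs of vertices: the factor 3 in the exponent gives `(2n)⁻³`,
which beats `2n²`. -/
lemma sq_mul_exp_le {n : ℕ} (hn : 1 ≤ n) {t : ℝ} (ht : 0 < t) :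
    (n : ℝ) ^ 2 * (2 * Real.exp (-(3 * (Real.log (2 * n) + t)))) ≤ Real.exp (-t) := by
  have hn0 : (1 : ℝ) ≤ n := by exact_mod_cast hn
  have e1 : Real.exp (-(3 * (Real.log (2 * n) + t))) =
      ((2 * (n : ℝ)) ^ 3)⁻¹ * Real.exp (-(3 * t)) := by
    rw [mul_add, neg_add, Real.exp_add, Real.exp_neg (3 * Real.log (2 * n))]
    congr 2
    rw [show (3 : ℝ) * Real.log (2 * n) = ((3 : ℕ) : ℝ) * Real.log (2 * n) by norm_num,
      Real.exp_nat_mul, Real.exp_log (by linarith)]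
  have e2 : Real.exp (-(3 * t)) ≤ Real.exp (-t) := Real.exp_le_exp.2 (by linarith)
  calc _ = (1 / (4 * n)) * Real.exp (-(3 * t)) := by
        rw [e1]
        field_simp
        ring
    _ ≤ 1 * Real.exp (-t) := by
        gcongr
        rw [div_le_one (by linarith)]
        linarith
    _ = _ := one_mul _

namespace DirGraph

variable {n m : ℕ}

lemma IsSquareGrid.one_le {G : DirGraph n m} (hG : G.IsSquareGrid) : 1 ≤ n := by
  obtain ⟨-, k, hk, ⟨φ⟩⟩ := hG
  exact Fin.pos (φ.symm (⟨0, hk⟩, ⟨0, hk⟩))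

theorem oracle_inequality (hn : 1 ≤ n) (G : DirGraph n m) {S : Set (Fin m)}
    (hS : G.ComponentsSquare S) (f₀ : Fin n → ℝ) {C σ x t lam : ℝ} (hC : 26 ≤ C) (hσ : 0 < σ)
    (hx : 0 < x) (ht : 0 < t) (hlam : C * gridLevel n σ t ≤ lam)
    {Ω : Type*} [MeasurableSpace Ω] {P : Measure Ω} [IsProbabilityMeasure P]
    {ε fhat : Ω → Fin n → ℝ} (hε : HasLaw ε (isotropicGaussian n σ) P)
    (hfhat : ∀ ω, IsAnalysisEstimator G.incidence lam (f₀ + ε ω) (fhat ω)) :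
    1 - Real.exp (-x) - Real.exp (-t) ≤
      P.real {ω | ∀ f : Fin n → ℝ, normSqN (fhat ω - f₀) ≤
        normSqN (f - f₀) + σ ^ 2 / n * (√(2 * x) + √(nullDim G.incidence S : ℝ)) ^ 2 +
          4 * lam * normL1 (G.incidence.mulVec f)} := by
  obtain ⟨b, A, hb, hA, hdec⟩ := G.exists_noise_decomposition S hS
  have hn0 : (0 : ℝ) < n := by exact_mod_cast hn
  have hlam0 : 0 ≤ lam := (mul_nonneg (by linarith) (gridLevel_nonneg hσ.le)).trans hlam
  set T := (√(2 * x) + √(nullDim G.incidence S : ℝ)) ^ 2 with hT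
  -- The level `n * lam / 2` makes `4 * τ / n` equal to `2 * lam`, the weight of the penalty.
  set Good : (Fin n → ℝ) → Prop := fun e => ∑ i, (∑ p, b i p * e p) ^ 2 ≤ σ ^ 2 * T ∧
    ∀ u w, |∑ p, A p u w * e p| ≤ n * lam / 2 with hGood
  have hmeas : MeasurableSet {e | Good e} := by
    have h1 : MeasurableSet {e : Fin n → ℝ | ∑ i, (∑ p, b i p * e p) ^ 2 ≤ σ ^ 2 * T} :=
      measurableSet_le (by fun_prop) (by fun_prop)
    have h2 : MeasurableSet {e : Fin n → ℝ | ∀ u w, |∑ p, A p u w * e p| ≤ n * lam / 2} := by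
      simp only [Set.ofPred_forall]
      exact MeasurableSet.iInter fun u => MeasurableSet.iInter fun w =>
        measurableSet_le (by fun_prop) (by fun_prop)
    exact h1.inter h2
  -- Only an inclusion is needed: the good event is measurable in the noise, while no measurability
  -- of `fhat` is required.
  have hdet : {ω | Good (ε ω)} ⊆ {ω | ∀ f : Fin n → ℝ, normSqN (fhat ω - f₀) ≤
        normSqN (f - f₀) + σ ^ 2 / n * T + 4 * lam * normL1 (G.incidence.mulVec f)} := by
    intro ω hω f
    have h1 := (hfhat ω).basic_ineq hlam0 f
    have h2 := hdec (ε ω) (fhat ω - f) _ hω.2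
    have h3 : normL1 (G.incidence.mulVec (fhat ω - f)) ≤
        normL1 (G.incidence.mulVec (fhat ω)) + normL1 (G.incidence.mulVec f) := by
      rw [Matrix.mulVec_sub]
      exact normL1_sub_le _ _
    have h4 : 2 * ((∑ i, ε ω i * (fhat ω - f) i) / n) ≤
        normSqN (fhat ω - f) + σ ^ 2 / n * T +
          2 * lam * normL1 (G.incidence.mulVec (fhat ω - f)) := by
      rw [← mul_div_assoc, div_le_iff₀ hn0]
      refine (h2.trans (add_le_add_left (add_le_add_right hω.1 _) _)).trans_eq ?_
      rw [normSqN]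
      field_simp
      ring
    have h5 := mul_le_mul_of_nonneg_left h3 (by linarith : 0 ≤ 2 * lam)
    linarith
  set γ : Measure (Fin n → ℝ) := Measure.pi fun _ => gaussianReal 0 1 with hγ
  set B₁ : Set (Fin n → ℝ) := {z | T < ∑ i, (∑ p, b i p * z p) ^ 2} with hB₁
  set B₂ : Fin n × Fin n → Set (Fin n → ℝ) := fun q =>
    {z | C / 2 * √(Real.log n * (Real.log (2 * n) + t)) < |∑ p, A p q.1 q.2 * z p|} with hB₂
  have hbad : {z : Fin n → ℝ | Good fun i => σ * z i}ᶜ ⊆ B₁ ∪ ⋃ q, B₂ q := by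
    intro z hz
    by_contra hnot
    simp only [Set.mem_union, Set.mem_iUnion, not_or, not_exists, hB₁, hB₂, Set.mem_ofPred_eq,
      not_lt] at hnot
    refine hz ⟨?_, fun u w => ?_⟩
    · have : ∀ i, (∑ p, b i p * (σ * z p)) ^ 2 = σ ^ 2 * (∑ p, b i p * z p) ^ 2 := by
        intro i
        rw [← mul_pow, Finset.mul_sum]
        congr 1
        exact Finset.sum_congr rfl fun p _ => by ring
      simp only [this, ← Finset.mul_sum]
      exact mul_le_mul_of_nonneg_left hnot.1 (sq_nonneg _)
    · have : ∑ p, A p u w * (σ * z p) = σ * ∑ p, A p u w * z p := by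
        rw [Finset.mul_sum]
        exact Finset.sum_congr rfl fun p _ => by ring
      rw [this, abs_mul, abs_of_pos hσ]
      refine (mul_le_mul_of_nonneg_left (hnot.2 (u, w)) hσ.le).trans ?_
      have h6 := mul_le_mul_of_nonneg_left hlam (by positivity : 0 ≤ (n : ℝ) / 2)
      refine le_trans (le_of_eq ?_) (h6.trans_eq (by ring))
      rw [gridLevel]
      field_simp
  have hprob : γ.real ({z : Fin n → ℝ | Good fun i => σ * z i}ᶜ) ≤
      Real.exp (-x) + Real.exp (-t) := by
    refine (measureReal_mono hbad).trans ((measureReal_union_le _ _).trans (add_le_add ?_ ?_))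
    · exact pi_gaussianReal_orthonormal_tail b hb hx
    · refine (measureReal_iUnion_fintype_le _).trans ?_
      refine (Finset.sum_le_sum fun q _ =>
        pi_gaussianReal_flow_tail hn (hA q.1 q.2) hC ht).trans ?_
      rw [Finset.sum_const, nsmul_eq_mul]
      refine le_trans (le_of_eq ?_) (sq_mul_exp_le hn ht)
      simp [sq]
  have hscale : Measurable fun (z : Fin n → ℝ) i => σ * z i := by fun_prop
  have hmeas' : MeasurableSet {z : Fin n → ℝ | Good fun i => σ * z i} := hscale hmeas
  have hP : P.real {ω | Good (ε ω)} = γ.real {z | Good fun i => σ * z i} := by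
    rw [hε.measureReal_eq hmeas, isotropicGaussian_eq_map, map_measureReal_apply hscale hmeas]
    rfl
  have hcompl := probReal_compl_eq_one_sub (μ := γ) hmeas'
  refine le_trans ?_ (measureReal_mono hdet)
  rw [hP]
  linarith

end DirGraph

/-! ### The rate under the canonical scaling -/

lemma sqrt_log_mul_le {n : ℕ} (hn : 2 ≤ n) {t : ℝ} (ht : 0 < t) :
    √(Real.log n * (Real.log (2 * n) + t)) ≤ (2 + 2 * t) * Real.log n := by
  have h2 : Real.log 2 ≤ Real.log n := Real.log_le_log (by norm_num) (by exact_mod_cast hn)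
  have h3 := Real.log_two_gt_d9
  have hpos : 0 < Real.log n := by linarith
  have hn0 : (n : ℝ) ≠ 0 := by positivity
  rw [Real.log_mul two_ne_zero hn0]
  refine Real.sqrt_le_iff.2 ⟨by positivity, ?_⟩
  have h4 : t ≤ 2 * t * Real.log n := by nlinarith
  calc Real.log n * (Real.log 2 + Real.log n + t)
      ≤ Real.log n * (Real.log n + Real.log n + 2 * t * Real.log n) := by gcongr
    _ = (2 + 2 * t) * 1 * Real.log n ^ 2 := by ring
    _ ≤ (2 + 2 * t) * (2 + 2 * t) * Real.log n ^ 2 := by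
      gcongr
      linarith
    _ = _ := by ring

/-- The constant in the rate of the estimator. -/
noncomputable def rateConst (C σ x t K M : ℝ) : ℝ :=
  2 * σ ^ 2 * (4 * x + M) + 4 * C * σ * K * (2 + 2 * t)

lemma oracle_bound_le_rate {n r : ℕ} (hn : 2 ≤ n) {C σ x t K M d : ℝ} (hC : 0 < C) (hσ : 0 < σ)
    (hx : 0 < x) (ht : 0 < t) (hK : 0 < K) (hr : (r : ℝ) ≤ M * (√(n : ℝ) * Real.log n))
    (hd : d ≤ K * √(n : ℝ)) :
    σ ^ 2 / n * (√(2 * x) + √(r : ℝ)) ^ 2 + 4 * (C * gridLevel n σ t) * d ≤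
      rateConst C σ x t K M * (Real.log n / √(n : ℝ)) := by
  have h2 : Real.log 2 ≤ Real.log n := Real.log_le_log (by norm_num) (by exact_mod_cast hn)
  have h3 := Real.log_two_gt_d9
  have hpos : 0 < Real.log n := by linarith
  have hn2 : (2 : ℝ) ≤ n := by exact_mod_cast hn
  set q := √(n : ℝ) with hq
  have hqq : q ^ 2 = n := Real.sq_sqrt (by linarith)
  have hq1 : 1 ≤ q := Real.one_le_sqrt.2 (by linarith)
  have hq0 : 0 < q := by linarith
  have hsq : (√(2 * x) + √(r : ℝ)) ^ 2 ≤ 2 * (4 * x + M) * (q * Real.log n) := by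
    have e1 : √(2 * x) ^ 2 = 2 * x := Real.sq_sqrt (by linarith)
    have e2 : √(r : ℝ) ^ 2 = r := Real.sq_sqrt (Nat.cast_nonneg _)
    -- As `log n ≥ log 2 > 1/2`, the constant term `2 * x` is absorbed into a multiple of `√n log
    -- n`.
    have e3 : 1 ≤ 2 * (q * Real.log n) := by nlinarith
    have e4 : 2 * x ≤ 4 * x * (q * Real.log n) := by nlinarith
    nlinarith [sq_nonneg (√(2 * x) - √(r : ℝ))]
  have hlev : gridLevel n σ t ≤ σ / q ^ 2 * ((2 + 2 * t) * Real.log n) := by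
    rw [gridLevel, hqq]
    gcongr
    exact sqrt_log_mul_le hn ht
  have hlev0 : 0 ≤ gridLevel n σ t := gridLevel_nonneg hσ.le
  have hKq : 4 * (C * gridLevel n σ t) * d ≤
      4 * C * σ * K * (2 + 2 * t) * (Real.log n / q) := by
    calc 4 * (C * gridLevel n σ t) * d
        ≤ 4 * (C * gridLevel n σ t) * (K * q) := by gcongr
      _ ≤ 4 * (C * (σ / q ^ 2 * ((2 + 2 * t) * Real.log n))) * (K * q) := by gcongr
      _ = _ := by field_simp
  calc _ ≤ σ ^ 2 / q ^ 2 * (2 * (4 * x + M) * (q * Real.log n)) +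
        4 * C * σ * K * (2 + 2 * t) * (Real.log n / q) := by
        rw [hqq]
        gcongr
    _ = _ := by
        rw [rateConst]
        field_simp

theorem corollary4p12 :
    ∃ C₀ : ℝ, 0 < C₀ ∧ ∀ C : ℝ, C₀ ≤ C →
      -- the oracle inequality
      (∀ (n m : ℕ) (G : DirGraph n m) (S : Set (Fin m)) (f₀ : Fin n → ℝ) (σ x t lam : ℝ),
        G.IsSquareGrid → S ∈ admissibleActiveSets G.incidence → G.ComponentsSquare S →
        0 < σ → 0 < x → 0 < t → C * gridLevel n σ t ≤ lam →
        ∀ (Ω : Type*) [MeasurableSpace Ω] (P : Measure Ω) [IsProbabilityMeasure P]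
          (ε fhat : Ω → Fin n → ℝ),
          HasLaw ε (isotropicGaussian n σ) P →
          (∀ ω, IsAnalysisEstimator G.incidence lam (f₀ + ε ω) (fhat ω)) →
          (∀ f : Fin n → ℝ,
            1 - Real.exp (-x) - Real.exp (-t) ≤
              P.real {ω | normSqN (fhat ω - f₀) ≤
                normSqN (f - f₀) +
                  σ ^ 2 / n * (√(2 * x) + √(nullDim G.incidence S : ℝ)) ^ 2 +
                  4 * lam * normL1 (G.incidence.mulVec f)}) ∧
          (lam = C * gridLevel n σ t →
            ∀ f : Fin n → ℝ,
              1 - Real.exp (-x) - Real.exp (-t) ≤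
                P.real {ω | normSqN (fhat ω - f₀) ≤
                  normSqN (f - f₀) +
                    σ ^ 2 / n * (√(2 * x) + √(nullDim G.incidence S : ℝ)) ^ 2 +
                    4 * C * (σ / n) * √(Real.log n * (Real.log (2 * n) + t)) *
                      normL1 (G.incidence.mulVec f)})) ∧
      -- the rate under the canonical scaling
      (∀ σ x t K M : ℝ, 0 < σ → 0 < x → 0 < t → 0 < K → 0 < M →
        ∃ A : ℝ, 0 < A ∧
          ∀ (n m : ℕ) (G : DirGraph n m) (S : Set (Fin m)) (f₀ : Fin n → ℝ),
            2 ≤ n → G.IsSquareGrid →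
            S ∈ admissibleActiveSets G.incidence → G.ComponentsSquare S →
            (nullDim G.incidence S : ℝ) ≤ M * (√(n : ℝ) * Real.log n) →
            normL1 (G.incidence.mulVec f₀) ≤ K * √(n : ℝ) →
            ∀ (Ω : Type*) [MeasurableSpace Ω] (P : Measure Ω) [IsProbabilityMeasure P]
              (ε fhat : Ω → Fin n → ℝ),
              HasLaw ε (isotropicGaussian n σ) P →
              (∀ ω, IsAnalysisEstimator G.incidence (C * gridLevel n σ t)
                (f₀ + ε ω) (fhat ω)) →
              1 - Real.exp (-x) - Real.exp (-t) ≤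
                P.real {ω | normSqN (fhat ω - f₀) ≤ A * (Real.log n / √(n : ℝ))}) := by
  refine ⟨26, by norm_num, fun C hC => ⟨?_, ?_⟩⟩
  · intro n m G S f₀ σ x t lam hG _ hS hσ hx ht hlam Ω _ P _ ε fhat hε hfhat
    have h := G.oracle_inequality hG.one_le hS f₀ hC hσ hx ht hlam hε hfhat
    refine ⟨fun f => h.trans (measureReal_mono fun ω hω => hω f), fun hlam_eq f => ?_⟩
    have e : 4 * C * (σ / n) * √(Real.log n * (Real.log (2 * n) + t)) = 4 * lam := by
      rw [hlam_eq, gridLevel]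
      ring
    rw [e]
    exact h.trans (measureReal_mono fun ω hω => hω f)
  · intro σ x t K M hσ hx ht hK hM
    have hC0 : 0 < C := by linarith
    refine ⟨rateConst C σ x t K M, by unfold rateConst; positivity, ?_⟩
    intro n m G S f₀ hn hG _ hS hr hd Ω _ P _ ε fhat hε hfhat
    have h := G.oracle_inequality hG.one_le hS f₀ hC hσ hx ht le_rfl hε hfhat
    refine h.trans (measureReal_mono fun ω hω => ?_)
    have h1 := hω f₀
    have h2 : normSqN (f₀ - f₀) = 0 := by simp [normSqN]
    rw [h2, zero_add] at h1
    exact h1.trans (oracle_bound_le_rate hn hC0 hσ hx ht hK hr hd)
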